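/- **Setting.** A weighted digraph $G=(V,E,w)$ consists of a finite vertex set $V$, a set of edges $E\subseteq\{(i,j)\in V\times V: i\neq j\}$ and weights $w:E\to\mathbb R_{>0}$ (in the subdivided digraphs below, weight $0$ is also allowed). For vertices $i,j$ let $d(i,j)\in[0,\infty]$ be the minimal total weight of a directed path from $i$ to $j$ ($\infty$ if there is none). For $t\ge 0$ let $G^t$ be the digraph on $V$ with an edge $(i,j)$ whenever $i\ne j$ and $d(i,j)\le t$. For a digraph $D$ let $(\Omega_\bullet(D),\partial)$ be its regular path complex over $\mathbb R$: $\Omega_p(D)$ is the space of linear combinations $x$ of allowed $p$-paths $v_0\dots v_p$ (i.e. all $(v_{k},v_{k+1})$ are edges of $D$) such that $\partial x$ is a linear combination of allowed $(p-1)$-paths, where $\partial(v_0\dots v_p)=\sum_k(-1)^k v_0\dots\hat v_k\dots v_p$ with terms having two equal consecutive vertices set to $0$. The *grounded persistent path homology* of $G$ is the persistent vector space over $t\in[0,\infty)$ $$\mathcal H_1(G)(t)=\frac{\ker\big(\partial:\Omega_1(G\cup G^t)\to\Omega_0(G\cup G^t)\big)}{\partial\,\Omega_2(G^t)},$$ with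 maps induced by inclusion. Its barcode is the multiset of intervals $I\subseteq[0,\infty)$ in a decomposition of $\mathcal H_1(G)$ as a direct sum of interval modules. The bottleneck distance $d_B\in[0,\infty]$ of two barcodes is the infimum, over partial matchings of their intervals, of the largest of the $\ell^\infty$ distances between endpoint pairs (birth, death) of matched intervals and the numbers $(\text{death}-\text{birth})/2$ of unmatched intervals (deaths may be $\infty$, with $|\infty-\infty|=0$). **Theorem.** Let $G=(V,E,w)$ be a weighted digraph, $e=(a,b)\in E$, $n\ge 0$, and let $S=(S_0,\dots,S_n)$ with $S_i\ge 0$ and $\sum_i S_i=1$. Let $G_S$ be obtained from $G$ by replacing $e$ with $n+1$ daughter edges $\tau_i=(v_i,v_{i+1})$, $0\le i\le n$, of weight $S_i\,w(e)$, where $v_0=a$, $v_{n+1}=b$ and $v_1,\dots,v_n$ are new vertices. Let $G_e=(V,E\setminus\{e\},w)$, and let $d_e$ be the shortest-path distance in $G_e$. Fix any daughter edge $\tau=\tau_i$, and let $G_S\setminus\tau$ be $G_S$ with the edge $\tau$ deleted (all vertices being kept). Then $\mathcal H_1(G_S)$ and $\mathcal H_1(G_S\setminus\tau)$ have barcodes,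 and their barcodes satisfy $$d_B\big(\mathrm{Barcode}(\mathcal H_1(G_S)),\ \mathrm{Barcode}(\mathcal H_1(G_S\setminus\tau))\big)\ \le\ \max\Big(d_e(a,b),\ \frac{w(e)}{2}\Big)$$ (where the right-hand side is $\infty$ if $d_e(a,b)=\infty$). -/

import Mathlib

open scoped NNReal ENNReal DirectSum

/-! ## Weighted digraphs -/

/-- A digraph without self-loops on the vertex set `V`, with nonnegative edge weights. The values of
`weight` at pairs which are not edges carry no information: nothing below depends on them.
(Weight `0` is permitted since a subdivision may give a daughter edge a zero share; the weighted
digraphs one starts from satisfy `IsPositive`.) -/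
structure WeightedDigraph (V : Type*) extends Digraph V where
  loopless : ∀ v, ¬ Adj v v
  weight : V → V → ℝ
  weight_nonneg : ∀ u v, Adj u v → 0 ≤ weight u v

namespace WeightedDigraph

universe u

section Basic

variable {V : Type u}

/-- All edge weights are positive. -/
def IsPositive (G : WeightedDigraph V) : Prop :=
  ∀ u v, G.Adj u v → 0 < G.weight u v

/-- `G.IsPath i j l`: the list `l` is the sequence of vertices of a directed path from `i` to `j`
(consecutive vertices are joined by forward edges and no vertex is repeated). -/
def IsPath (G : WeightedDigraph V) (i j : V) (l : List V) : Prop :=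
  l.head? = some i ∧ l.getLast? = some j ∧ l.IsChain G.Adj ∧ l.Nodup

/-- The length of a path: the sum of the weights of its edges. -/
def pathLength (G : WeightedDigraph V) : List V → ℝ
  | [] => 0
  | [_] => 0
  | u :: v :: l => G.weight u v + pathLength G (v :: l)

/-- The shortest-path quasimetric; it is `∞` if there is no path. -/
noncomputable def dist (G : WeightedDigraph V) (i j : V) : ℝ≥0∞ :=
  ⨅ (l : List V) (_ : G.IsPath i j l), ENNReal.ofReal (G.pathLength l)

/-- The digraph `G^t` of the shortest-path filtration. -/
def sublevel (G : WeightedDigraph V) (t : ℝ≥0) : Digraph V where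
  Adj i j := i ≠ j ∧ G.dist i j ≤ t

/-- Deletion of the edge `(x, y)`. -/
def deleteEdge (G : WeightedDigraph V) (x y : V) : WeightedDigraph V where
  Adj u v := G.Adj u v ∧ (u, v) ≠ (x, y)
  loopless v h := G.loopless v h.1
  weight := G.weight
  weight_nonneg u v h := G.weight_nonneg u v h.1

end Basic

/-! ## Subdivision of one edge -/

section Subdivision

variable {V : Type u}

/-- The vertices `v_0 = a, v_1, …, v_n, v_{n+1} = b` along an edge `(a, b)` which is subdivided into
`n + 1` daughter edges; `v_1, …, v_n` are new. -/
def subdivVertex (a b : V) (n : ℕ) : Fin (n + 2) → V ⊕ Fin n :=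
  Fin.cons (Sum.inl a) (Fin.snoc (fun k => Sum.inr k) (Sum.inl b) : Fin (n + 1) → V ⊕ Fin n)

/-- The edges after subdivision of `(a, b)`: the old edges other than `(a, b)`, and the daughter
edges `τ_i = (v_i, v_{i+1})` (numbered from `0`). -/
inductive SubdivAdj (G : WeightedDigraph V) (a b : V) (n : ℕ) : V ⊕ Fin n → V ⊕ Fin n → Prop
  | old (u v : V) : G.Adj u v → (u, v) ≠ (a, b) →
      SubdivAdj G a b n (Sum.inl u) (Sum.inl v)
  | daughter (i : Fin (n + 1)) :
      SubdivAdj G a b n (subdivVertex a b n i.castSucc) (subdivVertex a b n i.succ)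

open Classical in
/-- The weights after subdivision: `S i * w (a, b)` for the daughter `τ_i` (whose index can be read
off from its initial vertex), the old weight for an old edge; see `subdivWeight_daughter` and
`subdivWeight_old`. -/
noncomputable def subdivWeight (G : WeightedDigraph V) (a b : V) (n : ℕ) (S : Fin (n + 1) → ℝ) :
    V ⊕ Fin n → V ⊕ Fin n → ℝ
  | Sum.inl u, Sum.inl v => if (u, v) = (a, b) then S 0 * G.weight a b else G.weight u v
  | Sum.inl _, Sum.inr _ => S 0 * G.weight a b
  | Sum.inr k, _ => S k.succ * G.weight a b

theorem subdivVertex_zero (a b : V) (n : ℕ) : subdivVertex a b n 0 = Sum.inl a := rfl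

theorem subdivVertex_last (a b : V) (n : ℕ) :
    subdivVertex a b n (Fin.last (n + 1)) = Sum.inl b := by
  rw [← Fin.succ_last]
  simp [subdivVertex]

theorem subdivVertex_new (a b : V) (n : ℕ) (k : Fin n) :
    subdivVertex a b n k.castSucc.succ = Sum.inr k := by
  simp [subdivVertex]

theorem subdivWeight_old (G : WeightedDigraph V) (a b : V) (n : ℕ) (S : Fin (n + 1) → ℝ) (u v : V)
    (h : (u, v) ≠ (a, b)) :
    G.subdivWeight a b n S (Sum.inl u) (Sum.inl v) = G.weight u v := by
  simp [subdivWeight, h]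

theorem subdivWeight_daughter (G : WeightedDigraph V) (a b : V) (n : ℕ) (S : Fin (n + 1) → ℝ)
    (i : Fin (n + 1)) :
    G.subdivWeight a b n S (subdivVertex a b n i.castSucc) (subdivVertex a b n i.succ)
      = S i * G.weight a b := by
  induction i using Fin.cases with
  | zero =>
    rw [Fin.castSucc_zero, subdivVertex_zero]
    cases n with
    | zero =>
      have h : subdivVertex a b 0 (Fin.succ 0) = Sum.inl b := subdivVertex_last a b 0
      rw [h]
      simp [subdivWeight]
    | succ m =>
      have h : subdivVertex a b (m + 1) (Fin.succ 0) = Sum.inr 0 := subdivVertex_new a b (m + 1) 0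
      rw [h]
      rfl
  | succ k =>
    rw [← Fin.succ_castSucc, subdivVertex_new]
    rfl

theorem not_subdivAdj_self (G : WeightedDigraph V) {a b : V} (hab : G.Adj a b) (n : ℕ)
    (x y : V ⊕ Fin n) (h : SubdivAdj G a b n x y) : x ≠ y := by
  cases h with
  | old u v h _ =>
    intro e
    obtain rfl := Sum.inl.inj e
    exact G.loopless _ h
  | daughter i =>
    induction i using Fin.cases with
    | zero =>
      rw [Fin.castSucc_zero, subdivVertex_zero]
      cases n with
      | zero =>
        have h : subdivVertex a b 0 (Fin.succ 0) = Sum.inl b := subdivVertex_last a b 0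
        rw [h]
        intro e
        obtain rfl := Sum.inl.inj e
        exact G.loopless _ hab
      | succ m =>
        have h : subdivVertex a b (m + 1) (Fin.succ 0) = Sum.inr 0 := subdivVertex_new a b (m + 1) 0
        rw [h]
        simp
    | succ k =>
      rw [← Fin.succ_castSucc, subdivVertex_new]
      cases n with
      | zero => exact k.elim0
      | succ m =>
        induction k using Fin.lastCases with
        | last =>
          rw [Fin.succ_last, Fin.succ_last, subdivVertex_last]
          simp
        | cast k =>
          rw [← Fin.castSucc_succ, subdivVertex_new]
          intro e
          have := congrArg Fin.val (Sum.inr.inj e)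
          simp at this

/-- Subdivision of the edge `(a, b)` into `n + 1` daughter edges `τ_0, …, τ_n`, where `τ_i` receives
the share `S i` of the weight, for a point `S` of the standard `n`-simplex. -/
noncomputable def subdivide (G : WeightedDigraph V) {a b : V} (hab : G.Adj a b) {n : ℕ}
    (S : stdSimplex ℝ (Fin (n + 1))) : WeightedDigraph (V ⊕ Fin n) where
  Adj := SubdivAdj G a b n
  loopless x h := not_subdivAdj_self G hab n x x h rfl
  weight := G.subdivWeight a b n S.1
  weight_nonneg x y h := by
    cases h with
    | old u v h h' =>
      rw [subdivWeight_old G a b n S.1 u v h']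
      exact G.weight_nonneg u v h
    | daughter i =>
      rw [subdivWeight_daughter]
      exact mul_nonneg (S.2.1 i) (G.weight_nonneg a b hab)

end Subdivision

end WeightedDigraph

/-! ## The regular path complex, with real coefficients -/

namespace PathHomology

universe u

variable {V : Type u}

/-- `Λ_p`: the real vector space freely generated by the elementary `p`-paths `v_0 … v_p`. -/
def Chain (V : Type u) (p : ℕ) : Type u := (Fin (p + 1) → V) →₀ ℝ

noncomputable instance (V : Type u) (p : ℕ) : AddCommGroup (Chain V p) :=
  inferInstanceAs (AddCommGroup ((Fin (p + 1) → V) →₀ ℝ))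

noncomputable instance (V : Type u) (p : ℕ) : Module ℝ (Chain V p) :=
  inferInstanceAs (Module ℝ ((Fin (p + 1) → V) →₀ ℝ))

/-- The standard basis of `Λ_p`, consisting of the elementary `p`-paths. -/
noncomputable def pathBasis (V : Type u) (p : ℕ) :
    Module.Basis (Fin (p + 1) → V) ℝ (Chain V p) :=
  .ofRepr (LinearEquiv.refl ℝ ((Fin (p + 1) → V) →₀ ℝ))

/-- Consecutive vertices are distinct. -/
def IsRegularPath {p : ℕ} (v : Fin (p + 1) → V) : Prop :=
  ∀ i : Fin p, v i.castSucc ≠ v i.succ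

/-- Consecutive vertices are joined by forward edges. -/
def IsAllowedPath (D : Digraph V) {p : ℕ} (v : Fin (p + 1) → V) : Prop :=
  ∀ i : Fin p, D.Adj (v i.castSucc) (v i.succ)

/-- The non-regular boundary `v_0 … v_p ↦ ∑ (-1)^i v_0 … v̂_i … v_p`. -/
noncomputable def nonregularBoundary (V : Type u) (p : ℕ) : Chain V (p + 1) →ₗ[ℝ] Chain V p :=
  (pathBasis V (p + 1)).constr ℝ fun v =>
    ∑ i : Fin (p + 2), (-1 : ℝ) ^ (i : ℕ) • pathBasis V p (fun k => v (i.succAbove k))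

open Classical in
/-- The projection `π` onto the span of the regular paths, which kills the non-regular ones. -/
noncomputable def regularProj (V : Type u) (p : ℕ) : Chain V p →ₗ[ℝ] Chain V p :=
  (pathBasis V p).constr ℝ fun v => if IsRegularPath v then pathBasis V p v else 0

/-- The regular boundary (only ever applied to combinations of regular paths). -/
noncomputable def boundary (V : Type u) (p : ℕ) : Chain V (p + 1) →ₗ[ℝ] Chain V p :=
  regularProj V p ∘ₗ nonregularBoundary V p

/-- `𝒜_p(D)`: the span of the allowed `p`-paths. -/
noncomputable def allowedChains (D : Digraph V) (p : ℕ) : Submodule ℝ (Chain V p) :=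
  Submodule.span ℝ {x | ∃ v, IsAllowedPath D v ∧ x = pathBasis V p v}

/-- `Ω_p(D)`: the `∂`-invariant `p`-paths. -/
noncomputable def invariantChains (D : Digraph V) : (p : ℕ) → Submodule ℝ (Chain V p)
  | 0 => allowedChains D 0
  | p + 1 => allowedChains D (p + 1) ⊓ (allowedChains D p).comap (boundary V p)

theorem allowedChains_mono {D D' : Digraph V} (h : ∀ u v, D.Adj u v → D'.Adj u v) (p : ℕ) :
    allowedChains D p ≤ allowedChains D' p := by
  refine Submodule.span_mono ?_
  rintro x ⟨v, hv, rfl⟩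
  exact ⟨v, fun i => h _ _ (hv i), rfl⟩

theorem invariantChains_mono {D D' : Digraph V} (h : ∀ u v, D.Adj u v → D'.Adj u v) (p : ℕ) :
    invariantChains D p ≤ invariantChains D' p := by
  cases p with
  | zero => exact allowedChains_mono h 0
  | succ p =>
    exact inf_le_inf (allowedChains_mono h _) (Submodule.comap_mono (allowedChains_mono h _))

end PathHomology

/-! ## Persistent vector spaces and barcodes -/

/-- A persistent real vector space, with parameter in `[0, ∞)`. -/
structure PersistentSpace where
  space : ℝ≥0 → Type*
  [addCommGroup : ∀ t, AddCommGroup (space t)]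
  [module : ∀ t, Module ℝ (space t)]
  map : ∀ {s t : ℝ≥0}, s ≤ t → space s →ₗ[ℝ] space t
  map_refl : ∀ (t : ℝ≥0) (x : space t), map le_rfl x = x
  map_map : ∀ {r s t : ℝ≥0} (hrs : r ≤ s) (hst : s ≤ t) (x : space r),
    map hst (map hrs x) = map (hrs.trans hst) x

attribute [instance] PersistentSpace.addCommGroup PersistentSpace.module

/-- A multiset of (nonempty) intervals of `[0, ∞)`, as a family indexed by a type. -/
structure Barcode where
  Feature : Type
  interval : Feature → Set ℝ≥0
  nonempty : ∀ i, (interval i).Nonempty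
  ordConnected : ∀ i, (interval i).OrdConnected

/-- The vector space at time `t` of the interval module `P(I)`: it is `ℝ` if `t ∈ I`, and `0`
otherwise. -/
def intervalSpace (I : Set ℝ≥0) (t : ℝ≥0) : Submodule ℝ ℝ where
  carrier := {x | t ∉ I → x = 0}
  add_mem' hx hy h := by rw [hx h, hy h, add_zero]
  zero_mem' _ := rfl
  smul_mem' c x hx h := by rw [hx h, smul_zero]

open Classical in
/-- The structure maps of the interval module `P(I)`: the identity if `s, t ∈ I`, and `0`
otherwise. -/
noncomputable def intervalMap (I : Set ℝ≥0) (s t : ℝ≥0) :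
    intervalSpace I s →ₗ[ℝ] intervalSpace I t where
  toFun x := ⟨if s ∈ I ∧ t ∈ I then (x : ℝ) else 0, fun h => if_neg fun h' => h h'.2⟩
  map_add' x y := by ext; by_cases h : s ∈ I ∧ t ∈ I <;> simp [h]
  map_smul' c x := by ext; by_cases h : s ∈ I ∧ t ∈ I <;> simp [h]

/-- `M ≅ ⨁ P(I)`, the sum being over the features of the barcode `B`. -/
def PersistentSpace.HasBarcode (M : PersistentSpace) (B : Barcode) : Prop :=
  ∃ φ : ∀ t : ℝ≥0, M.space t ≃ₗ[ℝ] ⨁ i : B.Feature, intervalSpace (B.interval i) t,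
    ∀ (s t : ℝ≥0) (h : s ≤ t) (x : M.space s) (i : B.Feature),
      φ t (M.map h x) i = intervalMap (B.interval i) s t (φ s x i)

namespace Barcode

/-- The left endpoint of a feature. -/
noncomputable def birth (B : Barcode) (i : B.Feature) : ℝ≥0∞ :=
  ⨅ t ∈ B.interval i, (t : ℝ≥0∞)

/-- The right endpoint of a feature, possibly `∞`. -/
noncomputable def death (B : Barcode) (i : B.Feature) : ℝ≥0∞ :=
  ⨆ t ∈ B.interval i, (t : ℝ≥0∞)

/-- `|x - y|` on `[0, ∞]`, with `|∞ - ∞| = 0` and `|x - ∞| = ∞` for finite `x`. -/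
noncomputable def absDiff (x y : ℝ≥0∞) : ℝ≥0∞ := max (x - y) (y - x)

/-- The `ℓ^∞` distance between the points of the persistence diagrams given by two features. -/
noncomputable def pairCost (B C : Barcode) (i : B.Feature) (j : C.Feature) : ℝ≥0∞ :=
  max (absDiff (B.birth i) (C.birth j)) (absDiff (B.death i) (C.death j))

/-- The `ℓ^∞` distance from the point of the persistence diagram given by a feature to the
diagonal. -/
noncomputable def diagonalCost (B : Barcode) (i : B.Feature) : ℝ≥0∞ :=
  (B.death i - B.birth i) / 2

/-- The cost of a partial matching `γ`: the supremum of the distances between matched points, and of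
the distances of the unmatched points (on either side) to the diagonal. -/
noncomputable def matchingCost (B C : Barcode) (γ : B.Feature ≃. C.Feature) : ℝ≥0∞ :=
  max (⨆ (i : B.Feature) (j : C.Feature) (_ : γ i = some j), pairCost B C i j)
    (max (⨆ (i : B.Feature) (_ : γ i = none), B.diagonalCost i)
      (⨆ (j : C.Feature) (_ : γ.symm j = none), C.diagonalCost j))

/-- The bottleneck distance between two barcodes. -/
noncomputable def bottleneckDist (B C : Barcode) : ℝ≥0∞ :=
  ⨅ γ : B.Feature ≃. C.Feature, matchingCost B C γ

end Barcode

/-! ## Maps between subquotients -/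

section Subquotient

variable {M : Type*} [AddCommGroup M] [Module ℝ M]

/-- The map `Z / B → Z' / B'` induced by inclusions `Z ⊆ Z'` and `B ⊆ B'`. -/
def subquotientMap {Z Z' B B' : Submodule ℝ M} (hZ : Z ≤ Z') (hB : B ≤ B') :
    (Z ⧸ B.submoduleOf Z) →ₗ[ℝ] (Z' ⧸ B'.submoduleOf Z') :=
  Submodule.mapQ _ _ (Submodule.inclusion hZ) (fun _ hx => hB hx)

theorem subquotientMap_mk {Z Z' B B' : Submodule ℝ M} (hZ : Z ≤ Z') (hB : B ≤ B') (x : Z) :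
    subquotientMap hZ hB (Submodule.Quotient.mk x)
      = Submodule.Quotient.mk (Submodule.inclusion hZ x) :=
  rfl

theorem subquotientMap_refl {Z B : Submodule ℝ M} (x : Z ⧸ B.submoduleOf Z) :
    subquotientMap le_rfl le_rfl x = x := by
  obtain ⟨x, rfl⟩ := Submodule.Quotient.mk_surjective _ x
  rfl

theorem subquotientMap_subquotientMap {Z Z' Z'' B B' B'' : Submodule ℝ M} (hZ : Z ≤ Z')
    (hB : B ≤ B') (hZ' : Z' ≤ Z'') (hB' : B' ≤ B'') (x : Z ⧸ B.submoduleOf Z) :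
    subquotientMap hZ' hB' (subquotientMap hZ hB x)
      = subquotientMap (hZ.trans hZ') (hB.trans hB') x := by
  obtain ⟨x, rfl⟩ := Submodule.Quotient.mk_surjective _ x
  rfl

end Subquotient

/-! ## Grounded persistent path homology -/

namespace WeightedDigraph

open PathHomology

universe u

variable {V : Type u}

/-- The cycles, in degree `1`, of the grounded complex
`⋯ → Ω_2(G^t) → Ω_1(G ∪ G^t) → Ω_0(G ∪ G^t)`. -/
noncomputable def groundedCycles (G : WeightedDigraph V) (t : ℝ≥0) : Submodule ℝ (Chain V 1) :=
  invariantChains (G.toDigraph ⊔ G.sublevel t) 1 ⊓ LinearMap.ker (boundary V 0)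

/-- The boundaries, in degree `1`, of the grounded complex
`⋯ → Ω_2(G^t) → Ω_1(G ∪ G^t) → Ω_0(G ∪ G^t)`. -/
noncomputable def groundedBoundaries (G : WeightedDigraph V) (t : ℝ≥0) :
    Submodule ℝ (Chain V 1) :=
  (invariantChains (G.sublevel t) 2).map (boundary V 1)

/-- The grounded homology in degree `1` at time `t`: cycles modulo boundaries. -/
abbrev GroundedHomology (G : WeightedDigraph V) (t : ℝ≥0) : Type u :=
  G.groundedCycles t ⧸ (G.groundedBoundaries t).submoduleOf (G.groundedCycles t)

theorem sublevel_mono (G : WeightedDigraph V) {s t : ℝ≥0} (h : s ≤ t) (u v : V)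
    (huv : (G.sublevel s).Adj u v) : (G.sublevel t).Adj u v :=
  ⟨huv.1, huv.2.trans (ENNReal.coe_le_coe.2 h)⟩

theorem groundedCycles_mono (G : WeightedDigraph V) {s t : ℝ≥0} (h : s ≤ t) :
    G.groundedCycles s ≤ G.groundedCycles t := by
  refine inf_le_inf (invariantChains_mono ?_ 1) le_rfl
  rintro u v (huv | huv)
  · exact Or.inl huv
  · exact Or.inr (G.sublevel_mono h u v huv)

theorem groundedBoundaries_mono (G : WeightedDigraph V) {s t : ℝ≥0} (h : s ≤ t) :
    G.groundedBoundaries s ≤ G.groundedBoundaries t :=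
  Submodule.map_mono (invariantChains_mono (G.sublevel_mono h) 2)

/-- Grounded persistent path homology, in degree `1`; the maps are induced by the inclusions
`G^s ⊆ G^t` and `G ∪ G^s ⊆ G ∪ G^t`. -/
noncomputable def groundedPersistentHomology (G : WeightedDigraph V) : PersistentSpace.{u} where
  space t := G.GroundedHomology t
  map h := subquotientMap (G.groundedCycles_mono h) (G.groundedBoundaries_mono h)
  map_refl _ x := subquotientMap_refl x
  map_map hrs hst x :=
    subquotientMap_subquotientMap (G.groundedCycles_mono hrs) (G.groundedBoundaries_mono hrs)
      (G.groundedCycles_mono hst) (G.groundedBoundaries_mono hst) x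

end WeightedDigraph

/-!
Every grounded homology class is represented by a directed cycle of the digraph, so `H₁(G)` is, at
each time, a quotient of one fixed finite-dimensional space, the cycle space, and the kernels grow
with time. All bars are then born at `0`, and the barcode is determined by the dimensions of the
quotients: sorting the bars by length gives an optimal matching.

The cycles of `G_S ∖ τ` are the cycles of `G_S` with vanishing `τ`-coordinate, a subspace of
codimension one. Retract the vertices of `G_S ∖ τ` onto `V`, those before `τ` to `a` and those after
`τ` to `b`. A path of `G_S` retracts to a path that uses `(a, b)` at most once after shortening, and
a bypass can replace it, so the retraction raises distances by at most `d_e(a, b)`. As it is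
homotopic to the identity, a cycle of `G_S ∖ τ` that bounds in `G_S` at time `t` bounds in
`G_S ∖ τ` by time `t + d_e(a, b)`. In the complementary direction, the subdivided edge minus the
bypass is a cycle with non-zero `τ`-coordinate which bounds by time `max (d_e(a, b)) (w(e))`; it
accounts for the one bar left unmatched, at half that cost.
-/

/-! ## Linear algebra -/

section LinearAlgebra

open Module

section DivisionRing

variable {K N P Q : Type*} [DivisionRing K] [AddCommGroup N] [Module K N]

theorem exists_linearIndepOn_span_eq_of_isChain [FiniteDimensional K N] (W : Submodule K N)
    {C : Set (Submodule K N)} (hC : IsChain (· ≤ ·) C) :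
    ∃ s : Set N, LinearIndepOn K id s ∧ Submodule.span K s = W ∧
      ∀ c ∈ C, c ≤ W → c ≤ Submodule.span K (s ∩ c) := by
  induction W using WellFoundedLT.induction with
  | ind W ih =>
    obtain ⟨s, hs, hsW, hsC⟩ : ∃ s : Set N, LinearIndepOn K id s ∧ s ⊆ W ∧
        ∀ c ∈ C, c < W → c ≤ Submodule.span K (s ∩ c) := by
      rcases Set.eq_empty_or_nonempty {c ∈ C | c < W} with hempty | hne
      · exact ⟨∅, linearIndepOn_empty K id, Set.empty_subset _,
          fun c hc hcW => (hempty.subset ⟨hc, hcW⟩).elim⟩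
      · obtain ⟨M, ⟨hMC, hMW⟩, hmax⟩ := wellFounded_gt.has_min _ hne
        obtain ⟨s, hs, hspan, hsC⟩ := ih M hMW
        refine ⟨s, hs, Submodule.span_le.1 (hspan.trans_le hMW.le), fun c hc hcW => hsC c hc ?_⟩
        exact (hC.total hc hMC).elim id fun h => (eq_of_le_of_not_lt h (hmax c ⟨hc, hcW⟩)).ge
    obtain ⟨b, hbW, hsb, hspan, hb⟩ := exists_linearIndepOn_id_extension hs hsW
    have hspan_eq : Submodule.span K b = W := le_antisymm (Submodule.span_le.2 hbW) hspan
    refine ⟨b, hb, hspan_eq, fun c hc hcW => ?_⟩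
    rcases hcW.eq_or_lt with rfl | hlt
    · rw [Set.inter_eq_left.2 hbW, hspan_eq]
    · exact (hsC c hc hlt).trans (Submodule.span_mono (Set.inter_subset_inter_left _ hsb))

theorem exists_basis_mem_iff_of_isChain [FiniteDimensional K N] {C : Set (Submodule K N)}
    (hC : IsChain (· ≤ ·) C) :
    ∃ (m : ℕ) (b : Basis (Fin m) K N), ∀ c ∈ C, ∀ z,
      z ∈ c ↔ ∀ i, b i ∉ c → b.repr z i = 0 := by
  obtain ⟨s, hs, hspan, hsC⟩ := exists_linearIndepOn_span_eq_of_isChain ⊤ hC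
  have : Finite s := hs.finite
  let b := (Basis.mk hs.linearIndependent (by
    simp only [id, Subtype.range_coe, hspan, le_rfl])).reindex
    (Finite.equivFin s)
  refine ⟨_, b, fun c hc z => ⟨fun hz i hi => ?_, fun hz => ?_⟩⟩
  · have hsub : s ∩ c ⊆ b '' {i | b i ∈ c} := by
      rintro x ⟨hx, hxc⟩
      have hbx : b (Finite.equivFin s ⟨x, hx⟩) = x := by
        rw [Basis.reindex_apply, Equiv.symm_apply_apply, Basis.mk_apply, id]
      exact ⟨_, Set.mem_ofPred_eq ▸ hbx.symm ▸ hxc, hbx⟩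
    have hsupp := b.mem_span_image.1 (Submodule.span_mono hsub (hsC c hc le_top hz))
    exact Finsupp.notMem_support_iff.1 fun hi' => hi (hsupp hi')
  · rw [← b.sum_repr z]
    refine Submodule.sum_mem _ fun i _ => ?_
    by_cases hi : b i ∈ c
    · exact c.smul_mem _ hi
    · simp only [hz i hi, zero_smul, c.zero_mem]

theorem finrank_range_le_finrank_range_of_ker_le [AddCommGroup P] [Module K P] [AddCommGroup Q]
    [Module K Q] [FiniteDimensional K N] {f : N →ₗ[K] P} {g : N →ₗ[K] Q}
    (h : LinearMap.ker f ≤ LinearMap.ker g) :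
    finrank K (LinearMap.range g) ≤ finrank K (LinearMap.range f) := by
  have hf := f.finrank_range_add_finrank_ker
  have hg := g.finrank_range_add_finrank_ker
  have hker := Submodule.finrank_mono h
  omega

theorem finrank_map_ker_add_one [AddCommGroup P] [Module K P] [FiniteDimensional K P]
    {f : N →ₗ[K] P} (hf : Function.Surjective f) {l : Dual K N} (hl : l ≠ 0)
    (h : LinearMap.ker f ≤ LinearMap.ker l) :
    finrank K ((LinearMap.ker l).map f) + 1 = finrank K P := by
  obtain ⟨g, hg⟩ := f.exists_rightInverse_of_surjective (LinearMap.range_eq_top.2 hf)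
  have hgf : (l ∘ₗ g) ∘ₗ f = l := by
    ext x
    have hx : g (f x) - x ∈ LinearMap.ker f := by
      rw [LinearMap.mem_ker, map_sub, sub_eq_zero]
      exact LinearMap.congr_fun hg (f x)
    exact sub_eq_zero.1 ((map_sub l _ _).symm.trans (h hx))
  have hker : (LinearMap.ker l).map f = LinearMap.ker (l ∘ₗ g) := by
    conv_lhs => rw [← hgf, LinearMap.ker_comp, Submodule.map_comap_eq_of_surjective hf]
  rw [hker]
  refine Dual.finrank_ker_add_one_of_ne_zero fun h0 => hl ?_
  rw [← hgf, h0, LinearMap.zero_comp]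

theorem map_ker_eq_top_of_not_ker_le [AddCommGroup P] [Module K P] {f : N →ₗ[K] P}
    (hf : Function.Surjective f) {l : Dual K N} (h : ¬ LinearMap.ker f ≤ LinearMap.ker l) :
    (LinearMap.ker l).map f = ⊤ := by
  have hl : l ≠ 0 := by
    rintro rfl
    simp only [LinearMap.ker_zero, le_top, not_true_eq_false] at h
  have hcoatom : IsCoatom (LinearMap.ker l) :=
    LinearMap.isCoatom_ker_of_surjective (LinearMap.surjective hl)
  rw [LinearMap.map_eq_top_iff (f := f) (LinearMap.range_eq_top.2 hf)]
  exact hcoatom.2 _ (left_lt_sup.2 h)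

end DivisionRing

theorem exists_linearEquiv_apply_eq_of_ker_eq {R N P Q : Type*} [Ring R] [AddCommGroup N]
    [Module R N] [AddCommGroup P] [Module R P] [AddCommGroup Q] [Module R Q] {f : N →ₗ[R] P}
    {g : N →ₗ[R] Q} (hf : Function.Surjective f) (hg : Function.Surjective g)
    (h : LinearMap.ker f = LinearMap.ker g) : ∃ φ : P ≃ₗ[R] Q, ∀ x, φ (f x) = g x := by
  refine ⟨(f.quotKerEquivOfSurjective hf).symm ≪≫ₗ Submodule.quotEquivOfEq _ _ h ≪≫ₗ
    g.quotKerEquivOfSurjective hg, fun x => ?_⟩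
  have hx : (f.quotKerEquivOfSurjective hf).symm (f x) = Submodule.Quotient.mk x :=
    (LinearEquiv.symm_apply_eq _).2 rfl
  simp only [LinearEquiv.trans_apply, hx]
  rfl

end LinearAlgebra

/-! ## Persistent spaces with surjective structure maps -/

open Classical in
/-- The projection of `ℝ` onto the vector space at time `t` of the interval module `P(I)`. -/
noncomputable def intervalProj (I : Set ℝ≥0) (t : ℝ≥0) : ℝ →ₗ[ℝ] intervalSpace I t where
  toFun x := ⟨if t ∈ I then x else 0, fun h => if_neg h⟩
  map_add' x y := by ext; by_cases h : t ∈ I <;> simp [h]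
  map_smul' c x := by ext; by_cases h : t ∈ I <;> simp [h]

theorem intervalProj_of_mem {I : Set ℝ≥0} {t : ℝ≥0} (h : t ∈ I) (x : ℝ) :
    (intervalProj I t x : ℝ) = x := if_pos h

theorem intervalProj_of_notMem {I : Set ℝ≥0} {t : ℝ≥0} (h : t ∉ I) (x : ℝ) :
    (intervalProj I t x : ℝ) = 0 := if_neg h

theorem intervalProj_surjective (I : Set ℝ≥0) (t : ℝ≥0) :
    Function.Surjective (intervalProj I t) := by
  intro x
  refine ⟨x, Subtype.ext ?_⟩
  by_cases ht : t ∈ I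
  · exact intervalProj_of_mem ht _
  · exact (intervalProj_of_notMem ht _).trans (x.2 ht).symm

theorem intervalProj_eq_zero_iff {I : Set ℝ≥0} {t : ℝ≥0} {x : ℝ} :
    intervalProj I t x = 0 ↔ (t ∈ I → x = 0) := by
  rw [Subtype.ext_iff, Submodule.coe_zero]
  by_cases ht : t ∈ I
  · simp only [intervalProj_of_mem ht, ht, true_imp_iff]
  · simp only [intervalProj_of_notMem ht, ht, false_imp_iff]

theorem intervalMap_of_mem {I : Set ℝ≥0} {s t : ℝ≥0} (hs : s ∈ I) (ht : t ∈ I)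
    (x : intervalSpace I s) : (intervalMap I s t x : ℝ) = x := if_pos ⟨hs, ht⟩

theorem intervalMap_eq_zero {I : Set ℝ≥0} {s t : ℝ≥0} (h : ¬ (s ∈ I ∧ t ∈ I))
    (x : intervalSpace I s) : intervalMap I s t x = 0 := Subtype.ext (if_neg h)

theorem intervalMap_intervalProj {I : Set ℝ≥0} (hI : IsLowerSet I) {s t : ℝ≥0} (hst : s ≤ t)
    (x : ℝ) : intervalMap I s t (intervalProj I s x) = intervalProj I t x := by
  refine Subtype.ext ?_
  by_cases ht : t ∈ I
  · rw [intervalMap_of_mem (hI hst ht) ht, intervalProj_of_mem ht, intervalProj_of_mem (hI hst ht)]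
  · rw [intervalMap_eq_zero fun h => ht h.2, intervalProj_of_notMem ht, Submodule.coe_zero]

namespace PersistentSpace

/-- A presentation of `P` as a family of quotients of one fixed vector space `N`. It exists only
if all structure maps of `P` are surjective. -/
structure Presentation (P : PersistentSpace) (N : Type*) [AddCommGroup N] [Module ℝ N] where
  proj : ∀ t, N →ₗ[ℝ] P.space t
  surjective : ∀ t, Function.Surjective (proj t)
  map_proj : ∀ {s t : ℝ≥0} (h : s ≤ t) (x : N), P.map h (proj s x) = proj t x

namespace Presentation

variable {P : PersistentSpace} {N : Type*} [AddCommGroup N] [Module ℝ N]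

theorem ker_mono (π : P.Presentation N) {s t : ℝ≥0} (h : s ≤ t) :
    LinearMap.ker (π.proj s) ≤ LinearMap.ker (π.proj t) := fun x hx => by
  rw [LinearMap.mem_ker] at hx ⊢
  rw [← π.map_proj h, hx, map_zero]

theorem hasBarcode_of_coordinates (π : P.Presentation N) {B : Barcode} [Finite B.Feature]
    (hB : ∀ i, IsLowerSet (B.interval i)) {c : N →ₗ[ℝ] B.Feature → ℝ}
    (hc : Function.Surjective c)
    (hker : ∀ t z, π.proj t z = 0 ↔ ∀ i, t ∈ B.interval i → c z i = 0) : P.HasBarcode B := by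
  classical
  have := Fintype.ofFinite B.Feature
  let ψ (t : ℝ≥0) : N →ₗ[ℝ] ⨁ i : B.Feature, intervalSpace (B.interval i) t :=
    (DirectSum.linearEquivFunOnFintype ℝ B.Feature
      fun i => intervalSpace (B.interval i) t).symm.toLinearMap ∘ₗ
      LinearMap.pi fun i => intervalProj (B.interval i) t ∘ₗ LinearMap.proj i ∘ₗ c
  have hψ (t z i) : ψ t z i = intervalProj (B.interval i) t (c z i) :=
    congrFun ((DirectSum.linearEquivFunOnFintype ℝ B.Feature
      fun i => intervalSpace (B.interval i) t).apply_symm_apply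
        fun i => intervalProj (B.interval i) t (c z i)) i
  have hψsurj (t) : Function.Surjective (ψ t) := by
    intro y
    choose x hx using fun i => intervalProj_surjective (B.interval i) t (y i)
    obtain ⟨z, hz⟩ := hc x
    exact ⟨z, DFinsupp.ext fun i => by rw [hψ, hz, hx]⟩
  have hψker (t) : LinearMap.ker (π.proj t) = LinearMap.ker (ψ t) := by
    ext z
    rw [LinearMap.mem_ker, LinearMap.mem_ker, hker, DFinsupp.ext_iff]
    exact forall_congr' fun i => by
      rw [hψ, DFinsupp.zero_apply, intervalProj_eq_zero_iff]
  choose φ hφ using fun t => exists_linearEquiv_apply_eq_of_ker_eq (π.surjective t)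
    (hψsurj t) (hψker t)
  refine ⟨φ, fun s t h x i => ?_⟩
  obtain ⟨z, rfl⟩ := π.surjective s x
  rw [π.map_proj, hφ, hφ, hψ, hψ, intervalMap_intervalProj (hB i) h]

theorem exists_hasBarcode [FiniteDimensional ℝ N] (π : P.Presentation N) :
    ∃ B : Barcode, P.HasBarcode B := by
  classical
  obtain ⟨m, b, hb⟩ := exists_basis_mem_iff_of_isChain
    (C := Set.range fun t => LinearMap.ker (π.proj t)) (by
      rintro _ ⟨s, rfl⟩ _ ⟨t, rfl⟩ _
      exact (le_total s t).imp π.ker_mono π.ker_mono)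
  let B : Barcode :=
    { Feature := {i : Fin m // b i ∉ LinearMap.ker (π.proj 0)}
      interval := fun i => {t | b i ∉ LinearMap.ker (π.proj t)}
      nonempty := fun i => ⟨0, i.2⟩
      ordConnected := fun i => ⟨fun s _ t ht r hr h => ht (π.ker_mono hr.2 h)⟩ }
  have : Finite B.Feature := inferInstanceAs (Finite {i : Fin m // _})
  refine ⟨B, π.hasBarcode_of_coordinates (fun i s t hts hs h => hs (π.ker_mono hts h))
    (c := LinearMap.funLeft ℝ ℝ Subtype.val ∘ₗ b.equivFun.toLinearMap) ?_ fun t z => ?_⟩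
  · exact (LinearMap.funLeft_surjective_of_injective ℝ ℝ _ Subtype.val_injective).comp
      b.equivFun.surjective
  · refine (hb _ ⟨t, rfl⟩ z).trans ⟨fun h i hi => h i hi, fun h i hi => ?_⟩
    exact h ⟨i, fun h0 => hi (π.ker_mono zero_le h0)⟩ hi

end Presentation

end PersistentSpace

/-! ## Barcodes of initial intervals -/

open Classical in
/-- The basis of the vector space at time `t` of the interval module `P(I)`; it has one element if
`t ∈ I`, and none otherwise. -/
noncomputable def intervalBasis (I : Set ℝ≥0) (t : ℝ≥0) :
    Module.Basis (PLift (t ∈ I)) ℝ (intervalSpace I t) :=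
  .ofEquivFun
    { toFun := fun x _ => x
      invFun := fun f => ⟨if h : t ∈ I then f ⟨h⟩ else 0, fun h => dif_neg h⟩
      map_add' := fun _ _ => rfl
      map_smul' := fun _ _ => rfl
      left_inv := fun x => Subtype.ext (by
        by_cases h : t ∈ I
        · exact dif_pos h
        · exact (dif_neg h).trans (x.2 h).symm)
      right_inv := fun f => funext fun h => dif_pos h.down }

namespace Barcode

/-- The number of features of `B` whose interval contains the time `t`
(junk value `0` if there are infinitely many). -/
noncomputable def numAlive (B : Barcode) (t : ℝ≥0) : ℕ :=
  Nat.card {i // t ∈ B.interval i}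

/-- `B` has finitely many features, all of them alive at time `0`. -/
structure IsInitial (B : Barcode) : Prop where
  finite : Finite B.Feature
  zero_mem : ∀ i, 0 ∈ B.interval i

end Barcode

namespace PersistentSpace

variable {P : PersistentSpace} {B : Barcode}

theorem HasBarcode.nonempty_basis (hB : P.HasBarcode B) (t : ℝ≥0) :
    Nonempty (Module.Basis {i // t ∈ B.interval i} ℝ (P.space t)) := by
  obtain ⟨φ, -⟩ := hB
  let b : Module.Basis (Σ i : B.Feature, PLift (t ∈ B.interval i)) ℝ
    (⨁ i : B.Feature, intervalSpace (B.interval i) t) :=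
      DFinsupp.basis fun i => intervalBasis (B.interval i) t
  exact ⟨(b.map (φ t).symm).reindex (Equiv.sigmaPLiftEquivSubtype _)⟩

theorem HasBarcode.numAlive_eq_finrank (hB : P.HasBarcode B) (t : ℝ≥0) :
    B.numAlive t = Module.finrank ℝ (P.space t) := by
  obtain ⟨b⟩ := hB.nonempty_basis t
  exact (Module.finrank_eq_nat_card_basis b).symm

variable {N : Type*} [AddCommGroup N] [Module ℝ N]

theorem Presentation.zero_mem_interval (π : P.Presentation N) (hB : P.HasBarcode B)
    (i : B.Feature) : 0 ∈ B.interval i := by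
  classical
  obtain ⟨φ, hφ⟩ := hB
  by_contra h0
  obtain ⟨t, ht⟩ := B.nonempty i
  let y : ⨁ i : B.Feature, intervalSpace (B.interval i) t :=
    DirectSum.lof ℝ B.Feature (fun i => intervalSpace (B.interval i) t) i ⟨1, fun h => (h ht).elim⟩
  obtain ⟨z, hz⟩ := π.surjective t ((φ t).symm y)
  have hzero : y i = 0 := by
    rw [← (φ t).apply_symm_apply y, ← hz, ← π.map_proj zero_le z, hφ,
      intervalMap_eq_zero fun h => h0 h.1]
  rw [DirectSum.lof_apply, Subtype.ext_iff] at hzero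
  exact one_ne_zero hzero

theorem Presentation.isInitial [FiniteDimensional ℝ N] (π : P.Presentation N)
    (hB : P.HasBarcode B) : B.IsInitial where
  zero_mem := π.zero_mem_interval hB
  finite := by
    have := Module.Finite.of_surjective (π.proj 0) (π.surjective 0)
    obtain ⟨b⟩ := hB.nonempty_basis 0
    have := Module.Finite.finite_basis b
    exact Finite.of_equiv _ (Equiv.subtypeUnivEquiv (π.zero_mem_interval hB))

end PersistentSpace

theorem map_partialInv_eq_some_iff {α β F : Type*} {σ : F → α} (hσ : Function.Injective σ)
    (τ : F → β) (i : α) (j : β) :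
    (Function.partialInv σ i).map τ = some j ↔ ∃ k, σ k = i ∧ τ k = j := by
  simp only [Option.map_eq_some_iff, hσ.isPartialInv _ _]

theorem exists_pequiv_apply_eq_some_iff {α β F : Type*} {σ : F → α} {τ : F → β}
    (hσ : Function.Injective σ) (hτ : Function.Injective τ) :
    ∃ γ : α ≃. β, ∀ i j, γ i = some j ↔ ∃ k, σ k = i ∧ τ k = j := by
  refine ⟨⟨fun i => (Function.partialInv σ i).map τ, fun j => (Function.partialInv τ j).map σ,
    fun i j => ?_⟩, map_partialInv_eq_some_iff hσ τ⟩
  exact (map_partialInv_eq_some_iff hτ σ j i).trans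
    ((exists_congr fun _ => and_comm).trans (map_partialInv_eq_some_iff hσ τ i j).symm)

theorem exists_equivFin_mem_iff_lt_card {α F : Type*} [LinearOrder α] [Finite F]
    (I : F → LowerSet α) :
    ∃ e : Fin (Nat.card F) ≃ F, ∀ k t, t ∈ I (e k) ↔ (k : ℕ) < Nat.card {i // t ∈ I i} := by
  classical
  let I' (k : Fin (Nat.card F)) : (LowerSet α)ᵒᵈ :=
    OrderDual.toDual (I ((Finite.equivFin F).symm k))
  let e := (Tuple.sort I').trans (Finite.equivFin F).symm
  have hanti (j k) (hjk : j ≤ k) : I (e k) ≤ I (e j) := Tuple.monotone_sort I' hjk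
  refine ⟨e, fun k t => ?_⟩
  have hcard : Nat.card {i // t ∈ I i} = Finset.card {k | t ∈ I (e k)} := by
    rw [← Fintype.card_subtype, ← Nat.card_eq_fintype_card]
    exact Nat.card_congr (e.subtypeEquiv fun k => Iff.rfl).symm
  rw [hcard]
  exact (Fin.lt_card_filter_univ_iff_apply_of_imp _ fun j k hkj hj => hanti k j hkj hj).symm

theorem exists_equiv_mem_iff_of_card_eq {α F F' : Type*} [LinearOrder α] [Finite F] [Finite F']
    {I : F → LowerSet α} {I' : F' → LowerSet α} (hF : Nat.card F = Nat.card F')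
    (hI : ∀ t, Nat.card {i // t ∈ I i} = Nat.card {i // t ∈ I' i}) :
    ∃ e : F ≃ F', ∀ i t, t ∈ I' (e i) ↔ t ∈ I i := by
  obtain ⟨e, he⟩ := exists_equivFin_mem_iff_lt_card I
  obtain ⟨e', he'⟩ := exists_equivFin_mem_iff_lt_card I'
  refine ⟨e.symm.trans ((finCongr hF).trans e'), fun i t => ?_⟩
  rw [Equiv.trans_apply, Equiv.trans_apply, he', ← hI, finCongr_apply, Fin.val_cast, ← he,
    Equiv.apply_symm_apply]

theorem card_subtype_fin_lt {p q : ℕ} (h : q ≤ p) : Nat.card {k : Fin p // (k : ℕ) < q} = q := by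
  rw [Nat.card_eq_fintype_card, Fintype.card_subtype, Fin.card_filter_val_lt, Nat.min_eq_right h]

theorem card_subtype_plift {p q : Prop} [Decidable q] (h : q → p) :
    Nat.card {_u : PLift p // q} = if q then 1 else 0 := by
  split_ifs with hq
  · have : Unique {_u : PLift p // q} := ⟨⟨⟨⟨h hq⟩, hq⟩⟩, fun _ => rfl⟩
    exact Nat.card_unique
  · have : IsEmpty {_u : PLift p // q} := ⟨fun u => hq u.2⟩
    exact Nat.card_of_isEmpty

namespace Barcode

variable {B C : Barcode}

theorem bottleneckDist_le_of_injective {F : Type*} {σ : F → B.Feature} {τ : F → C.Feature}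
    (hσ : Function.Injective σ) (hτ : Function.Injective τ) {r : ℝ≥0∞}
    (hpair : ∀ k, pairCost B C (σ k) (τ k) ≤ r)
    (hB : ∀ i, i ∉ Set.range σ → B.diagonalCost i ≤ r)
    (hC : ∀ j, j ∉ Set.range τ → C.diagonalCost j ≤ r) : bottleneckDist B C ≤ r := by
  obtain ⟨γ, hγ⟩ := exists_pequiv_apply_eq_some_iff hσ hτ
  refine (iInf_le _ γ).trans (max_le ?_ (max_le ?_ ?_))
  · refine iSup₂_le fun i j => iSup_le fun hij => ?_
    obtain ⟨k, rfl, rfl⟩ := (hγ i j).1 hij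
    exact hpair k
  · refine iSup₂_le fun i hi => hB i ?_
    rintro ⟨k, rfl⟩
    simp [(hγ _ _).2 ⟨k, rfl, rfl⟩] at hi
  · refine iSup₂_le fun j hj => hC j ?_
    rintro ⟨k, rfl⟩
    simp [(PEquiv.eq_some_iff γ).2 ((hγ _ _).2 ⟨k, rfl, rfl⟩)] at hj

theorem diagonalCost_le (i : B.Feature) {m : ℝ≥0} (h : ∀ t ∈ B.interval i, t ≤ m) :
    B.diagonalCost i ≤ (m : ℝ≥0∞) / 2 :=
  ENNReal.div_le_div_right (tsub_le_self.trans
    (iSup₂_le fun t ht => ENNReal.coe_le_coe.2 (h t ht))) 2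

theorem birth_eq_zero {i : B.Feature} (h : 0 ∈ B.interval i) : B.birth i = 0 :=
  le_antisymm (iInf₂_le 0 h) zero_le

theorem le_death {i : B.Feature} {t : ℝ≥0} (h : t ∈ B.interval i) : (t : ℝ≥0∞) ≤ B.death i :=
  le_iSup₂ (f := fun (t : ℝ≥0) (_ : t ∈ B.interval i) => (t : ℝ≥0∞)) t h

theorem pairCost_le {i : B.Feature} {j : C.Feature} (hi : 0 ∈ B.interval i)
    (hij : B.interval i ⊆ C.interval j) {d : ℝ≥0}
    (hd : ∀ t, t + d ∈ C.interval j → t ∈ B.interval i) : pairCost B C i j ≤ d := by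
  have hdeath : C.death j ≤ d + B.death i := by
    refine iSup₂_le fun t ht => ?_
    rcases le_total t d with htd | htd
    · exact (ENNReal.coe_le_coe.2 htd).trans le_self_add
    · have hmem : t - d ∈ B.interval i := hd _ (by rwa [tsub_add_cancel_of_le htd])
      calc (t : ℝ≥0∞) = d + (t - d : ℝ≥0) := by
            rw [← ENNReal.coe_add, add_tsub_cancel_of_le htd]
        _ ≤ d + B.death i := by gcongr; exact le_death hmem
  have hmono : B.death i ≤ C.death j := biSup_mono hij
  rw [pairCost, birth_eq_zero hi, birth_eq_zero (hij hi)]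
  refine max_le ?_ (max_le ?_ (tsub_le_iff_right.2 hdeath))
  · exact (max_le tsub_le_self tsub_le_self).trans zero_le
  · exact (tsub_eq_zero_of_le hmono).trans_le zero_le

/-- The interval of a feature of a barcode all of whose features are alive at time `0`. -/
def IsInitial.lowerSet (hB : B.IsInitial) (i : B.Feature) : LowerSet ℝ≥0 where
  carrier := B.interval i
  lower' _ _ hts ht := (B.ordConnected i).out (hB.zero_mem i) ht ⟨zero_le, hts⟩

theorem IsInitial.card_feature (hB : B.IsInitial) : Nat.card B.Feature = B.numAlive 0 :=
  (Nat.card_congr (Equiv.subtypeUnivEquiv hB.zero_mem)).symm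

theorem IsInitial.antitone_numAlive (hB : B.IsInitial) : Antitone B.numAlive := by
  intro s t hst
  have := hB.finite
  exact Nat.card_le_card_of_injective (Subtype.map id fun i hi => (hB.lowerSet i).lower hst hi)
    (Subtype.map_injective _ Function.injective_id)

theorem IsInitial.exists_equivFin (hB : B.IsInitial) :
    ∃ e : Fin (B.numAlive 0) ≃ B.Feature, ∀ k t, t ∈ B.interval (e k) ↔ (k : ℕ) < B.numAlive t := by
  have := hB.finite
  rw [← hB.card_feature]
  exact exists_equivFin_mem_iff_lt_card hB.lowerSet

open Classical in
theorem IsInitial.exists_equiv_sum_of_numAlive_eq (hB : B.IsInitial) {h : ℝ≥0 → ℕ} (hh : Antitone h)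
    (U : LowerSet ℝ≥0) (hBh : ∀ t, B.numAlive t = h t + if t ∈ U then 1 else 0) :
    ∃ e : Fin (h 0) ⊕ PLift (0 ∈ U) ≃ B.Feature,
      (∀ k t, t ∈ B.interval (e (Sum.inl k)) ↔ (k : ℕ) < h t) ∧
        ∀ u t, t ∈ B.interval (e (Sum.inr u)) ↔ t ∈ U := by
  let I : Fin (h 0) ⊕ PLift (0 ∈ U) → LowerSet ℝ≥0 :=
    Sum.elim (fun k => ⟨{t | (k : ℕ) < h t}, fun _ _ hts ht => ht.trans_le (hh hts)⟩) fun _ => U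
  have hcard (t) : Nat.card {x // t ∈ I x} = Nat.card {i // t ∈ hB.lowerSet i} := by
    rw [Nat.card_congr Equiv.subtypeSum, Nat.card_sum]
    exact (congrArg₂ (· + ·) (card_subtype_fin_lt (hh zero_le))
      (card_subtype_plift (U.lower zero_le))).trans (hBh t).symm
  have := hB.finite
  have hI (x) : 0 ∈ I x := by
    rcases x with k | u
    · exact k.2
    · exact u.down
  have hcard' : Nat.card (Fin (h 0) ⊕ PLift (0 ∈ U)) = Nat.card B.Feature :=
    (Nat.card_congr (Equiv.subtypeUnivEquiv hI)).symm.trans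
      ((hcard 0).trans hB.card_feature.symm)
  obtain ⟨e, he⟩ := exists_equiv_mem_iff_of_card_eq hcard' hcard
  exact ⟨e, fun k t => he _ t, fun u t => he _ t⟩

open Classical in
theorem bottleneckDist_le_of_numAlive (hB : B.IsInitial) (hC : C.IsInitial) {h : ℝ≥0 → ℕ}
    (hh : Antitone h) (U : LowerSet ℝ≥0) {d m : ℝ≥0} (hU : ∀ t ∈ U, t ≤ m)
    (hBh : ∀ t, B.numAlive t = h t + if t ∈ U then 1 else 0) (hhC : ∀ t, h t ≤ C.numAlive t)
    (hCh : ∀ t, C.numAlive (t + d) ≤ h t) : bottleneckDist B C ≤ max (d : ℝ≥0∞) (m / 2) := by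
  obtain ⟨e, he, heU⟩ := hB.exists_equiv_sum_of_numAlive_eq hh U hBh
  obtain ⟨e', he'⟩ := hC.exists_equivFin
  refine bottleneckDist_le_of_injective (e.injective.comp Sum.inl_injective)
    (e'.injective.comp (Fin.castLE_injective (hhC 0))) (fun k => le_max_of_le_left ?_)
    (fun i hi => le_max_of_le_right ?_) fun j hj => le_max_of_le_left ?_
  · refine pairCost_le ((he k 0).2 k.2) (fun t ht => (he' _ t).2 ?_) fun t ht => (he k t).2 ?_
    · exact ((he k t).1 ht).trans_le (hhC t)
    · exact ((he' _ _).1 ht).trans_le (hCh t)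
  · obtain ⟨k | u, rfl⟩ := e.surjective i
    · exact (hi ⟨k, rfl⟩).elim
    · exact diagonalCost_le _ fun t ht => hU t ((heU u t).1 ht)
  · obtain ⟨k, rfl⟩ := e'.surjective j
    have hk : h 0 ≤ k := by
      by_contra hk
      exact hj ⟨⟨k, not_le.1 hk⟩, rfl⟩
    refine (diagonalCost_le (m := d) _ fun t ht => ?_).trans ENNReal.half_le_self
    by_contra htd
    have hkt := (he' k t).1 ht
    have hd := hCh 0
    rw [zero_add] at hd
    have := hC.antitone_numAlive (not_le.1 htd).le
    omega

end Barcode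

namespace PersistentSpace.Presentation

variable {P Q : PersistentSpace} {N N' : Type*} [AddCommGroup N] [Module ℝ N] [AddCommGroup N']
  [Module ℝ N']

open Classical in
theorem finrank_space_eq [FiniteDimensional ℝ N] (π : P.Presentation N) {l : Module.Dual ℝ N}
    (hl : l ≠ 0) (t : ℝ≥0) :
    Module.finrank ℝ (P.space t) = Module.finrank ℝ ((LinearMap.ker l).map (π.proj t)) +
      if LinearMap.ker (π.proj t) ≤ LinearMap.ker l then 1 else 0 := by
  have := Module.Finite.of_surjective (π.proj t) (π.surjective t)
  split_ifs with h
  · exact (finrank_map_ker_add_one (π.surjective t) hl h).symm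
  · rw [map_ker_eq_top_of_not_ker_le (π.surjective t) h, finrank_top, add_zero]

/-- The functional `l` is killed by time `m`, which costs one bar of length at most `m`; all other
bars of `P` come from `ker l` and are matched, up to `d`, with those of `Q`. -/
theorem bottleneckDist_le [FiniteDimensional ℝ N] [FiniteDimensional ℝ N'] (π : P.Presentation N)
    (ρ : Q.Presentation N') {B C : Barcode} (hB : P.HasBarcode B) (hC : Q.HasBarcode C)
    {l : Module.Dual ℝ N} {ι : N' →ₗ[ℝ] N} (hι : LinearMap.range ι = LinearMap.ker l) {d m : ℝ≥0}
    (hker : ∀ t, LinearMap.ker (ρ.proj t) ≤ LinearMap.ker (π.proj t ∘ₗ ι))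
    (hker' : ∀ t, LinearMap.ker (π.proj t ∘ₗ ι) ≤ LinearMap.ker (ρ.proj (t + d)))
    (hm : ¬ LinearMap.ker (π.proj m) ≤ LinearMap.ker l) :
    Barcode.bottleneckDist B C ≤ max (d : ℝ≥0∞) (m / 2) := by
  classical
  have hl : l ≠ 0 := by
    rintro rfl
    simp only [LinearMap.ker_zero, le_top, not_true_eq_false] at hm
  have hρ (t) : C.numAlive t = Module.finrank ℝ (LinearMap.range (ρ.proj t)) := by
    rw [hC.numAlive_eq_finrank, LinearMap.range_eq_top.2 (ρ.surjective t), finrank_top]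
  let U : LowerSet ℝ≥0 :=
    ⟨{t | LinearMap.ker (π.proj t) ≤ LinearMap.ker l}, fun s t hts hs => (π.ker_mono hts).trans hs⟩
  refine Barcode.bottleneckDist_le_of_numAlive (π.isInitial hB) (ρ.isInitial hC)
    (h := fun t => Module.finrank ℝ (LinearMap.range (π.proj t ∘ₗ ι))) (fun s t hst => ?_) U
    (fun t ht => ?_) (fun t => ?_) (fun t => ?_) fun t => ?_
  · exact finrank_range_le_finrank_range_of_ker_le (fun x hx => π.ker_mono hst hx)
  · by_contra htm
    exact hm ((π.ker_mono (not_le.1 htm).le).trans ht)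
  · rw [hB.numAlive_eq_finrank, LinearMap.range_comp, hι]
    exact π.finrank_space_eq hl t
  · rw [hρ]
    exact finrank_range_le_finrank_range_of_ker_le (hker t)
  · rw [hρ]
    exact finrank_range_le_finrank_range_of_ker_le (hker' t)

end PersistentSpace.Presentation

/-! ## Path homology in low degrees -/

namespace PathHomology

universe u

variable {V : Type u} {W : Type*}

instance [Finite V] (p : ℕ) : FiniteDimensional ℝ (Chain V p) :=
  Module.Finite.of_basis (pathBasis V p)

theorem mem_allowedChains_iff {D : Digraph V} {p : ℕ} {x : Chain V p} :
    x ∈ allowedChains D p ↔ ∀ v, ¬ IsAllowedPath D v → (pathBasis V p).repr x v = 0 := by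
  have himage : {x | ∃ v, IsAllowedPath D v ∧ x = pathBasis V p v} =
      pathBasis V p '' {v | IsAllowedPath D v} := by
    ext x
    exact exists_congr fun v => and_congr_right fun _ => eq_comm
  rw [allowedChains, himage, (pathBasis V p).mem_span_image]
  exact forall_congr' fun v => by rw [Finset.mem_coe, Finsupp.mem_support_iff, not_imp_comm]; rfl

theorem allowedChains_zero (D : Digraph V) : allowedChains D 0 = ⊤ :=
  eq_top_iff.2 fun _ _ => mem_allowedChains_iff.2 fun _ hv => absurd (fun i => i.elim0) hv

theorem invariantChains_one (D : Digraph V) : invariantChains D 1 = allowedChains D 1 := by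
  rw [invariantChains, allowedChains_zero, Submodule.comap_top, inf_top_eq]

theorem isAllowedPath_one {D : Digraph V} {v : Fin 2 → V} :
    IsAllowedPath D (p := 1) v ↔ D.Adj (v 0) (v 1) := by
  simp [IsAllowedPath]

theorem isAllowedPath_two {D : Digraph V} {v : Fin 3 → V} :
    IsAllowedPath D (p := 2) v ↔ D.Adj (v 0) (v 1) ∧ D.Adj (v 1) (v 2) := by
  simp [IsAllowedPath, Fin.forall_fin_two]

theorem isRegularPath_one {v : Fin 2 → V} : IsRegularPath (p := 1) v ↔ v 0 ≠ v 1 := by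
  simp [IsRegularPath]

theorem isRegularPath_two {v : Fin 3 → V} :
    IsRegularPath (p := 2) v ↔ v 0 ≠ v 1 ∧ v 1 ≠ v 2 := by
  simp [IsRegularPath, Fin.forall_fin_two]

theorem regularProj_of_regular {p : ℕ} {v : Fin (p + 1) → V} (h : IsRegularPath v) :
    regularProj V p (pathBasis V p v) = pathBasis V p v := by
  rw [regularProj, Module.Basis.constr_basis, if_pos h]

theorem regularProj_of_not_regular {p : ℕ} {v : Fin (p + 1) → V} (h : ¬ IsRegularPath v) :
    regularProj V p (pathBasis V p v) = 0 := by
  rw [regularProj, Module.Basis.constr_basis, if_neg h]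

/-- The regular `1`-chain of a pair of vertices, with the convention that it is `0` if the vertices
agree. -/
noncomputable def edgeChain (u v : V) : Chain V 1 := regularProj V 1 (pathBasis V 1 ![u, v])

theorem edgeChain_self (u : V) : edgeChain u u = 0 :=
  regularProj_of_not_regular fun h => isRegularPath_one.1 h rfl

theorem edgeChain_of_ne {u v : V} (h : u ≠ v) : edgeChain u v = pathBasis V 1 ![u, v] :=
  regularProj_of_regular (isRegularPath_one.2 h)

theorem eq_vec_two (v : Fin 2 → V) : v = ![v 0, v 1] :=
  (FinVec.etaExpand_eq v).symm

theorem edgeChain_mem {D : Digraph V} {u v : V} (h : u ≠ v → D.Adj u v) :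
    edgeChain u v ∈ allowedChains D 1 := by
  by_cases huv : u = v
  · rw [huv, edgeChain_self]
    exact Submodule.zero_mem _
  · rw [edgeChain_of_ne huv]
    exact Submodule.subset_span ⟨_, isAllowedPath_one.2 (h huv), rfl⟩

theorem boundary_zero_pathBasis (v : Fin 2 → V) :
    boundary V 0 (pathBasis V 1 v) = pathBasis V 0 ![v 1] - pathBasis V 0 ![v 0] := by
  have hreg (w) : regularProj V 0 (pathBasis V 0 w) = pathBasis V 0 w :=
    regularProj_of_regular fun i => i.elim0
  have hface₀ : (fun k : Fin 1 => v (Fin.succAbove 0 k)) = ![v 1] :=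
    (FinVec.etaExpand_eq _).symm
  have hface₁ : (fun k : Fin 1 => v (Fin.succAbove 1 k)) = ![v 0] :=
    (FinVec.etaExpand_eq _).symm
  rw [boundary, LinearMap.comp_apply, nonregularBoundary, Module.Basis.constr_basis,
    Fin.sum_univ_two, hface₀, hface₁]
  simp [hreg, sub_eq_add_neg]

theorem boundary_one_pathBasis (v : Fin 3 → V) :
    boundary V 1 (pathBasis V 2 v) =
      edgeChain (v 1) (v 2) - edgeChain (v 0) (v 2) + edgeChain (v 0) (v 1) := by
  have hface₀ : (fun k : Fin 2 => v (Fin.succAbove 0 k)) = ![v 1, v 2] := eq_vec_two _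
  have hface₁ : (fun k : Fin 2 => v (Fin.succAbove 1 k)) = ![v 0, v 2] := eq_vec_two _
  have hface₂ : (fun k : Fin 2 => v (Fin.succAbove 2 k)) = ![v 0, v 1] := eq_vec_two _
  rw [boundary, LinearMap.comp_apply, nonregularBoundary, Module.Basis.constr_basis,
    Fin.sum_univ_three, hface₀, hface₁, hface₂]
  simp [sub_eq_add_neg, edgeChain]

theorem boundary_edgeChain (u v : V) :
    boundary V 0 (edgeChain u v) = pathBasis V 0 ![v] - pathBasis V 0 ![u] := by
  by_cases h : u = v
  · rw [h, edgeChain_self, map_zero, sub_self]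
  · rw [edgeChain_of_ne h, boundary_zero_pathBasis]
    rfl

theorem boundary_boundary (x : Chain V 2) : boundary V 0 (boundary V 1 x) = 0 := by
  have h : boundary V 0 ∘ₗ boundary V 1 = 0 := (pathBasis V 2).ext fun v => by
    rw [LinearMap.comp_apply, boundary_one_pathBasis, map_add, map_sub, boundary_edgeChain,
      boundary_edgeChain, boundary_edgeChain, LinearMap.zero_apply]
    abel
  exact LinearMap.congr_fun h x

/-- The map of regular chains induced by a map of vertices: the elementary path `v_0 … v_p` goes to
`φ(v_0) … φ(v_p)`, or to `0` if the latter is not regular. -/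
noncomputable def pushforward (φ : V → W) (p : ℕ) : Chain V p →ₗ[ℝ] Chain W p :=
  (pathBasis V p).constr ℝ fun v => regularProj W p (pathBasis W p (φ ∘ v))

theorem pushforward_pathBasis (φ : V → W) (p : ℕ) (v : Fin (p + 1) → V) :
    pushforward φ p (pathBasis V p v) = regularProj W p (pathBasis W p (φ ∘ v)) :=
  Module.Basis.constr_basis _ _ _ _

theorem pushforward_one_pathBasis (φ : V → W) (v : Fin 2 → V) :
    pushforward φ 1 (pathBasis V 1 v) = edgeChain (φ (v 0)) (φ (v 1)) := by
  rw [pushforward_pathBasis, eq_vec_two (φ ∘ v)]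
  rfl

theorem pushforward_edgeChain (φ : V → W) (u v : V) :
    pushforward φ 1 (edgeChain u v) = edgeChain (φ u) (φ v) := by
  by_cases h : u = v
  · rw [h, edgeChain_self, edgeChain_self, map_zero]
  · rw [edgeChain_of_ne h, pushforward_one_pathBasis]
    rfl

theorem boundary_pushforward (φ : V → W) (x : Chain V 2) :
    boundary W 1 (pushforward φ 2 x) = pushforward φ 1 (boundary V 1 x) := by
  have h : boundary W 1 ∘ₗ pushforward φ 2 = pushforward φ 1 ∘ₗ boundary V 1 :=
    (pathBasis V 2).ext fun v => by
      rw [LinearMap.comp_apply, LinearMap.comp_apply, boundary_one_pathBasis,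
        pushforward_pathBasis, map_add, map_sub, pushforward_edgeChain, pushforward_edgeChain,
        pushforward_edgeChain]
      by_cases hr : IsRegularPath (p := 2) (φ ∘ v)
      · rw [regularProj_of_regular hr, boundary_one_pathBasis]
        rfl
      · rw [regularProj_of_not_regular hr, map_zero]
        simp only [isRegularPath_two, not_and_or, not_not, Function.comp_apply] at hr
        rcases hr with hr | hr <;> rw [hr, edgeChain_self] <;> abel
  exact LinearMap.congr_fun h x

theorem pushforward_mem_allowedChains {D : Digraph V} {D' : Digraph W} {φ : V → W}
    (hφ : ∀ u v, D.Adj u v → φ u ≠ φ v → D'.Adj (φ u) (φ v)) {p : ℕ} {x : Chain V p}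
    (hx : x ∈ allowedChains D p) : pushforward φ p x ∈ allowedChains D' p := by
  refine Submodule.mem_comap.1
    ((Submodule.span_le (p := (allowedChains D' p).comap (pushforward φ p))).2 ?_ hx)
  rintro _ ⟨v, hv, rfl⟩
  rw [SetLike.mem_coe, Submodule.mem_comap, pushforward_pathBasis]
  by_cases hr : IsRegularPath (φ ∘ v)
  · rw [regularProj_of_regular hr]
    exact Submodule.subset_span ⟨_, fun i => hφ _ _ (hv i) (hr i), rfl⟩
  · rw [regularProj_of_not_regular hr]
    exact Submodule.zero_mem _

theorem pushforward_mem_boundaries {D : Digraph V} {D' : Digraph W} {φ : V → W}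
    (hφ : ∀ u v, D.Adj u v → φ u ≠ φ v → D'.Adj (φ u) (φ v)) {x : Chain V 1}
    (hx : x ∈ (invariantChains D 2).map (boundary V 1)) :
    pushforward φ 1 x ∈ (invariantChains D' 2).map (boundary W 1) := by
  obtain ⟨y, ⟨hy, hy'⟩, rfl⟩ := hx
  refine ⟨pushforward φ 2 y, ⟨pushforward_mem_allowedChains hφ hy, ?_⟩, boundary_pushforward φ y⟩
  rw [SetLike.mem_coe, Submodule.mem_comap, boundary_pushforward]
  exact pushforward_mem_allowedChains hφ hy'

theorem pushforward_eq_self_of_homotopy {D : Digraph V} {φ : V → V} (κ : V → Chain V 1)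
    (hκ : ∀ u v, D.Adj u v → κ v - κ u = edgeChain u v - edgeChain (φ u) (φ v))
    (hD : ∀ v, ¬ D.Adj v v) {x : Chain V 1} (hx : x ∈ allowedChains D 1)
    (hx' : boundary V 0 x = 0) : pushforward φ 1 x = x := by
  let K : Chain V 0 →ₗ[ℝ] Chain V 1 := (pathBasis V 0).constr ℝ fun v => κ (v 0)
  have hK : ∀ v, K (pathBasis V 0 v) = κ (v 0) := fun v => Module.Basis.constr_basis _ _ _ _
  have hhomotopy : Set.EqOn (K ∘ₗ boundary V 0)
      (LinearMap.id - pushforward φ 1 : Chain V 1 →ₗ[ℝ] Chain V 1) (allowedChains D 1) := by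
    refine LinearMap.eqOn_span ?_
    rintro _ ⟨v, hv, rfl⟩
    have hadj := isAllowedPath_one.1 hv
    have hne : v 0 ≠ v 1 := fun h => hD (v 1) (by rwa [h] at hadj)
    rw [LinearMap.comp_apply, boundary_zero_pathBasis, map_sub, hK, hK, LinearMap.sub_apply,
      pushforward_one_pathBasis]
    refine (hκ _ _ hadj).trans ?_
    rw [edgeChain_of_ne hne, ← eq_vec_two v]
    rfl
  have hsub : 0 = x - pushforward φ 1 x := by
    rw [← map_zero K, ← hx']
    exact hhomotopy hx
  exact (sub_eq_zero.1 hsub.symm).symm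

end PathHomology

/-! ## The shortest-path quasimetric -/

namespace WeightedDigraph

open PathHomology

universe u

section Distance

variable {V : Type u} {G : WeightedDigraph V}

theorem pathLength_nonneg {l : List V} (h : l.IsChain G.Adj) : 0 ≤ G.pathLength l := by
  induction h with
  | nil => exact le_rfl
  | singleton => exact le_rfl
  | cons_cons huv _ ih => exact add_nonneg (G.weight_nonneg _ _ huv) ih

theorem pathLength_le_of_isSuffix {l l' : List V} (hl : l <:+ l') (h : l'.IsChain G.Adj) :
    G.pathLength l ≤ G.pathLength l' := by
  induction h with
  | nil => rw [List.suffix_nil.1 hl]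
  | singleton u =>
    obtain rfl | hl := List.suffix_cons_iff.1 hl
    · exact le_rfl
    · rw [List.suffix_nil.1 hl]
      exact le_rfl
  | cons_cons huv _ ih =>
    obtain rfl | hl := List.suffix_cons_iff.1 hl
    · exact le_rfl
    · exact (ih hl).trans (le_add_of_nonneg_left (G.weight_nonneg _ _ huv))

theorem dist_le_pathLength {i j : V} {l : List V} (h : G.IsPath i j l) :
    G.dist i j ≤ ENNReal.ofReal (G.pathLength l) :=
  iInf₂_le l h

theorem dist_self (i : V) : G.dist i i = 0 :=
  nonpos_iff_eq_zero.1 ((dist_le_pathLength (l := [i])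
    ⟨rfl, rfl, List.isChain_singleton i, List.nodup_singleton i⟩).trans_eq ENNReal.ofReal_zero)

theorem IsPath.exists_eq_cons {i j : V} {l : List V} (h : G.IsPath i j l) : ∃ l', l = i :: l' :=
  List.head?_eq_some_iff.1 h.1

theorem IsPath.of_append {i j k : V} {s l : List V} (h : G.IsPath i j (s ++ k :: l)) :
    G.IsPath k j (k :: l) := by
  obtain ⟨-, hlast, hchain, hnodup⟩ := h
  refine ⟨rfl, ?_, hchain.right_of_append, (List.nodup_append.1 hnodup).2.1⟩
  rwa [List.getLast?_append_of_ne_nil _ (List.cons_ne_nil _ _)] at hlast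

theorem IsPath.cons {i j k : V} {l : List V} (hij : G.Adj i j) (h : G.IsPath j k l) (hi : i ∉ l) :
    G.IsPath i k (i :: l) := by
  obtain ⟨l, rfl⟩ := h.exists_eq_cons
  obtain ⟨-, hlast, hchain, hnodup⟩ := h
  exact ⟨rfl, hlast, hchain.cons_cons hij, List.nodup_cons.2 ⟨hi, hnodup⟩⟩

theorem dist_le_weight_add_dist {i j : V} (hij : G.Adj i j) (k : V) :
    G.dist i k ≤ ENNReal.ofReal (G.weight i j) + G.dist j k := by
  refine (le_iInf₂ fun l hl => ?_).trans_eq (ENNReal.add_iInf₂ ..).symm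
  by_cases hi : i ∈ l
  · obtain ⟨s, l', rfl⟩ := List.append_of_mem hi
    exact le_add_left ((dist_le_pathLength hl.of_append).trans
      (ENNReal.ofReal_le_ofReal (pathLength_le_of_isSuffix (List.suffix_append _ _) hl.2.2.1)))
  · refine (dist_le_pathLength (hl.cons hij hi)).trans_eq ?_
    have hlength := pathLength_nonneg hl.2.2.1
    obtain ⟨l, rfl⟩ := hl.exists_eq_cons
    exact ENNReal.ofReal_add (G.weight_nonneg i j hij) hlength

theorem IsPath.induction {j : V} {motive : V → ℝ → Prop} (nil : motive j 0)
    (cons : ∀ {i k r}, G.Adj i k → 0 ≤ r → G.dist k j ≤ ENNReal.ofReal r → motive k r →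
      motive i (G.weight i k + r)) {i : V} {l : List V} (h : G.IsPath i j l) :
    motive i (G.pathLength l) := by
  induction l generalizing i with
  | nil => simp [IsPath] at h
  | cons u l ih =>
    obtain rfl : u = i := Option.some.inj h.1
    cases l with
    | nil =>
      obtain rfl : u = j := Option.some.inj h.2.1
      exact nil
    | cons v l =>
      obtain ⟨huv, hchain⟩ := List.isChain_cons_cons.1 h.2.2.1
      have hpath : G.IsPath v j (v :: l) := IsPath.of_append (s := [u]) h
      exact cons huv (pathLength_nonneg hchain) (dist_le_pathLength hpath) (ih hpath)

theorem le_dist_add {F : V → ℝ≥0∞}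
    (hF : ∀ i j, G.Adj i j → F i ≤ ENNReal.ofReal (G.weight i j) + F j) (i j : V) :
    F i ≤ G.dist i j + F j := by
  rw [dist, ENNReal.iInf₂_add]
  refine le_iInf₂ fun l hl => ?_
  refine hl.induction (motive := fun i r => F i ≤ ENNReal.ofReal r + F j) ?_ ?_
  · rw [ENNReal.ofReal_zero, zero_add]
  · intro i k r hik hr _ ih
    rw [ENNReal.ofReal_add (G.weight_nonneg i k hik) hr, add_assoc]
    exact (hF i k hik).trans (by gcongr)

theorem dist_triangle (i j k : V) : G.dist i k ≤ G.dist i j + G.dist j k :=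
  le_dist_add (fun _ _ h => dist_le_weight_add_dist h k) i j

theorem dist_le_weight {i j : V} (hij : G.Adj i j) :
    G.dist i j ≤ ENNReal.ofReal (G.weight i j) := by
  simpa only [dist_self, add_zero] using dist_le_weight_add_dist hij j

theorem dist_le_dist_deleteEdge (x y i j : V) : G.dist i j ≤ (G.deleteEdge x y).dist i j := by
  simpa only [dist_self, add_zero] using
    le_dist_add (G := G.deleteEdge x y) (F := fun i => G.dist i j)
      (fun _ _ h => dist_le_weight_add_dist h.1 j) i j

theorem exists_isPath_pathLength_eq_dist [Finite V] {i j : V} (h : G.dist i j ≠ ⊤) :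
    ∃ l, G.IsPath i j l ∧ ENNReal.ofReal (G.pathLength l) = G.dist i j := by
  classical
  have := Fintype.ofFinite V
  have : Finite {l // G.IsPath i j l} :=
    Finite.of_injective (fun l => (⟨l.1, l.2.2.2.2⟩ : {l : List V // l.Nodup}))
      fun _ _ h => Subtype.ext (Subtype.mk.inj h)
  rw [dist, iInf_subtype'] at h ⊢
  have : Nonempty {l // G.IsPath i j l} := by
    by_contra hempty
    rw [not_nonempty_iff] at hempty
    exact h (iInf_of_empty _)
  obtain ⟨l, hl⟩ := exists_eq_ciInf_of_finite
    (f := fun l : {l // G.IsPath i j l} => ENNReal.ofReal (G.pathLength l.1))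
  exact ⟨l, l.2, hl⟩

end Distance

/-! ## Grounded homology as a quotient of the cycle space -/

section Cycles

variable {V : Type u} (G : WeightedDigraph V)

/-- The cycle space of `G`: the cycles supported on the edges of `G` itself, whatever the time. -/
noncomputable def cycles : Submodule ℝ (Chain V 1) :=
  allowedChains G.toDigraph 1 ⊓ LinearMap.ker (boundary V 0)

variable {G}

theorem cycles_le_groundedCycles (t : ℝ≥0) : G.cycles ≤ G.groundedCycles t := by
  rw [cycles, groundedCycles, invariantChains_one]
  exact inf_le_inf (allowedChains_mono (D := G.toDigraph) (fun _ _ h => Or.inl h) 1) le_rfl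

theorem boundary_eq_zero_of_mem_groundedBoundaries {t : ℝ≥0} {x : Chain V 1}
    (hx : x ∈ G.groundedBoundaries t) : boundary V 0 x = 0 := by
  obtain ⟨y, -, rfl⟩ := hx
  exact boundary_boundary y

theorem triangle_mem_groundedBoundaries {t : ℝ≥0} {u v w : V} (huv : G.dist u v ≤ t)
    (hvw : G.dist v w ≤ t) (huw : G.dist u w ≤ t) :
    edgeChain u w - (edgeChain u v + edgeChain v w) ∈ G.groundedBoundaries t := by
  by_cases huv' : u = v
  · rw [huv', edgeChain_self, zero_add, sub_self]
    exact Submodule.zero_mem _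
  by_cases hvw' : v = w
  · rw [hvw', edgeChain_self, add_zero, sub_self]
    exact Submodule.zero_mem _
  have hboundary : boundary V 1 (pathBasis V 2 ![u, v, w]) =
      edgeChain v w - edgeChain u w + edgeChain u v := boundary_one_pathBasis ![u, v, w]
  refine ⟨-pathBasis V 2 ![u, v, w], Submodule.neg_mem _ ⟨?_, ?_⟩, ?_⟩
  · exact Submodule.subset_span ⟨_, isAllowedPath_two.2 ⟨⟨huv', huv⟩, ⟨hvw', hvw⟩⟩, rfl⟩
  · rw [SetLike.mem_coe, Submodule.mem_comap, hboundary]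
    exact Submodule.add_mem _ (Submodule.sub_mem _ (edgeChain_mem fun h => ⟨h, hvw⟩)
      (edgeChain_mem fun h => ⟨h, huw⟩)) (edgeChain_mem fun h => ⟨h, huv⟩)
  · rw [map_neg, hboundary]
    abel

theorem exists_edgeChain_sub_mem_groundedBoundaries [Finite V] {t : ℝ≥0} {i j : V}
    (h : G.dist i j ≤ t) :
    ∃ x ∈ allowedChains G.toDigraph 1, edgeChain i j - x ∈ G.groundedBoundaries t := by
  obtain ⟨l, hl, hlength⟩ := exists_isPath_pathLength_eq_dist (ne_top_of_le_ne_top (by simp) h)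
  refine hl.induction (motive := fun i r => ENNReal.ofReal r ≤ t →
    ∃ x ∈ allowedChains G.toDigraph 1, edgeChain i j - x ∈ G.groundedBoundaries t) ?_ ?_
    (hlength.trans_le h)
  · refine fun _ => ⟨0, Submodule.zero_mem _, ?_⟩
    rw [edgeChain_self, sub_zero]
    exact Submodule.zero_mem _
  · intro i k r hik hr hkj ih hle
    rw [ENNReal.ofReal_add (G.weight_nonneg i k hik) hr] at hle
    obtain ⟨x, hx, hxt⟩ := ih (le_add_self.trans hle)
    have htriangle := triangle_mem_groundedBoundaries
      ((dist_le_weight hik).trans (le_self_add.trans hle)) (hkj.trans (le_add_self.trans hle))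
      ((dist_le_weight_add_dist hik j).trans ((add_le_add_right hkj _).trans hle))
    refine ⟨edgeChain i k + x, Submodule.add_mem _ (edgeChain_mem fun _ => hik) hx, ?_⟩
    convert Submodule.add_mem _ hxt htriangle using 1
    abel

theorem groundedCycles_le [Finite V] (t : ℝ≥0) :
    G.groundedCycles t ≤ G.cycles ⊔ G.groundedBoundaries t := by
  have hallowed : allowedChains (G.toDigraph ⊔ G.sublevel t) 1 ≤
      allowedChains G.toDigraph 1 ⊔ G.groundedBoundaries t := by
    refine Submodule.span_le.2 ?_
    rintro _ ⟨v, hv, rfl⟩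
    rcases isAllowedPath_one.1 hv with hv | ⟨hne, hv⟩
    · exact Submodule.mem_sup_left (Submodule.subset_span ⟨v, isAllowedPath_one.2 hv, rfl⟩)
    · obtain ⟨x, hx, hxt⟩ := exists_edgeChain_sub_mem_groundedBoundaries hv
      rw [edgeChain_of_ne hne, ← eq_vec_two v] at hxt
      exact Submodule.mem_sup.2 ⟨x, hx, _, hxt, add_sub_cancel _ _⟩
  rintro z ⟨hz, hz'⟩
  rw [invariantChains_one] at hz
  obtain ⟨x, hx, y, hy, rfl⟩ := Submodule.mem_sup.1 (hallowed hz)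
  rw [SetLike.mem_coe, LinearMap.mem_ker, map_add, boundary_eq_zero_of_mem_groundedBoundaries hy,
    add_zero] at hz'
  exact Submodule.add_mem_sup ⟨hx, hz'⟩ hy

variable (G)

/-- The presentation of grounded homology by the cycle space: every class, at every time, is
represented by a cycle of the digraph itself. -/
noncomputable def cyclePresentation [Finite V] :
    G.groundedPersistentHomology.Presentation G.cycles where
  proj t := ((G.groundedBoundaries t).submoduleOf (G.groundedCycles t)).mkQ ∘ₗ
    Submodule.inclusion (cycles_le_groundedCycles t)
  surjective t q := by
    obtain ⟨z, rfl⟩ := Submodule.mkQ_surjective _ q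
    obtain ⟨x, hx, y, hy, hxy⟩ := Submodule.mem_sup.1 (groundedCycles_le t z.2)
    refine ⟨⟨x, hx⟩, (Submodule.Quotient.eq _).2 ?_⟩
    change x - z.1 ∈ G.groundedBoundaries t
    rw [← hxy, sub_add_cancel_left]
    exact Submodule.neg_mem _ hy
  map_proj _ _ := rfl

variable {G}

theorem mem_ker_cyclePresentation_proj [Finite V] {t : ℝ≥0} {z : G.cycles} :
    z ∈ LinearMap.ker (G.cyclePresentation.proj t) ↔ (z : Chain V 1) ∈ G.groundedBoundaries t :=
  Submodule.Quotient.mk_eq_zero _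

theorem groundedBoundaries_deleteEdge_le (x y : V) (t : ℝ≥0) :
    (G.deleteEdge x y).groundedBoundaries t ≤ G.groundedBoundaries t :=
  Submodule.map_mono (invariantChains_mono (D := (G.deleteEdge x y).sublevel t)
    (D' := G.sublevel t) (fun u v h => ⟨h.1, (dist_le_dist_deleteEdge x y u v).trans h.2⟩) 2)

theorem cycles_deleteEdge (x y : V) :
    (G.deleteEdge x y).cycles = G.cycles ⊓ LinearMap.ker ((pathBasis V 1).coord ![x, y]) := by
  ext z
  simp only [cycles, Submodule.mem_inf, mem_allowedChains_iff, isAllowedPath_one,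
    LinearMap.mem_ker, Module.Basis.coord_apply]
  constructor
  · rintro ⟨h, hz⟩
    exact ⟨⟨fun v hv => h v fun hv' => hv hv'.1, hz⟩, h _ fun hv => hv.2 rfl⟩
  · rintro ⟨⟨h, hz⟩, hxy⟩
    refine ⟨fun v hv => ?_, hz⟩
    by_cases hv' : (v 0, v 1) = (x, y)
    · rw [Prod.mk.injEq] at hv'
      rwa [eq_vec_two v, hv'.1, hv'.2]
    · exact h v fun hadj => hv ⟨hadj, hv'⟩

theorem bottleneckDist_deleteEdge_le [Finite V] (x y : V) {d m : ℝ≥0}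
    (hd : ∀ t, ∀ z ∈ (G.deleteEdge x y).cycles, z ∈ G.groundedBoundaries t →
      z ∈ (G.deleteEdge x y).groundedBoundaries (t + d))
    (hm : ∃ z ∈ G.cycles, z ∈ G.groundedBoundaries m ∧ (pathBasis V 1).coord ![x, y] z ≠ 0)
    {B C : Barcode} (hB : G.groundedPersistentHomology.HasBarcode B)
    (hC : (G.deleteEdge x y).groundedPersistentHomology.HasBarcode C) :
    Barcode.bottleneckDist B C ≤ max (d : ℝ≥0∞) (m / 2) := by
  have hle : (G.deleteEdge x y).cycles ≤ G.cycles := cycles_deleteEdge x y ▸ inf_le_left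
  obtain ⟨z, hz, hzm, hzxy⟩ := hm
  refine G.cyclePresentation.bottleneckDist_le (G.deleteEdge x y).cyclePresentation hB hC
    (l := (pathBasis V 1).coord ![x, y] ∘ₗ G.cycles.subtype) (ι := Submodule.inclusion hle) ?_
    (fun t z hz => ?_) (fun t z hz => ?_) fun hker => ?_
  · ext z
    rw [Submodule.range_inclusion, Submodule.mem_comap, cycles_deleteEdge, LinearMap.ker_comp]
    exact and_iff_right z.2
  · rw [LinearMap.ker_comp, Submodule.mem_comap, mem_ker_cyclePresentation_proj]
    exact groundedBoundaries_deleteEdge_le x y t (mem_ker_cyclePresentation_proj.1 hz)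
  · rw [LinearMap.ker_comp, Submodule.mem_comap, mem_ker_cyclePresentation_proj] at hz
    exact mem_ker_cyclePresentation_proj.2 (hd t z z.2 hz)
  · exact hzxy (hker (mem_ker_cyclePresentation_proj (z := ⟨z, hz⟩).2 hzm))

end Cycles

end WeightedDigraph

/-! ## Cutting a subdivided edge -/

theorem partialSum_last {M : Type*} [AddCommMonoid M] {n : ℕ} (f : Fin n → M) :
    Fin.partialSum f (Fin.last n) = ∑ j, f j := by
  rw [Fin.partialSum, Fin.val_last, List.take_of_length_le (List.length_ofFn).le, List.sum_ofFn]

theorem succ_le_castSucc_iff_of_ne {n : ℕ} {i j : Fin n} (hj : j ≠ i) :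
    j.succ ≤ i.castSucc ↔ j.castSucc ≤ i.castSucc := by
  rw [Fin.succ_le_castSucc_iff, Fin.castSucc_le_castSucc_iff]
  exact ⟨le_of_lt, fun h => lt_of_le_of_ne h hj⟩

namespace WeightedDigraph

open PathHomology

universe u

section CutSubdivision

variable {V : Type u}

/-- The digraph `G_S \ τ_i`: the subdivision `G_S` of `G` with the daughter edge `τ_i` deleted. -/
noncomputable abbrev cutSubdivision (G : WeightedDigraph V) {a b : V} (hab : G.Adj a b) {n : ℕ}
    (S : stdSimplex ℝ (Fin (n + 1))) (i : Fin (n + 1)) : WeightedDigraph (V ⊕ Fin n) :=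
  (G.subdivide hab S).deleteEdge (subdivVertex a b n i.castSucc) (subdivVertex a b n i.succ)

variable (a b : V) {n : ℕ} (i : Fin (n + 1))

theorem subdivVertex_cases {motive : Fin (n + 2) → V ⊕ Fin n → Prop}
    (zero : motive 0 (Sum.inl a)) (last : motive (Fin.last (n + 1)) (Sum.inl b))
    (new : ∀ k : Fin n, motive k.castSucc.succ (Sum.inr k)) (m : Fin (n + 2)) :
    motive m (subdivVertex a b n m) := by
  induction m using Fin.cases with
  | zero => exact zero
  | succ m =>
    induction m using Fin.lastCases with
    | last =>
      rw [Fin.succ_last, subdivVertex_last]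
      exact last
    | cast k =>
      rw [subdivVertex_new]
      exact new k

/-- The retraction of `G_S \ τ_i` onto the old vertices: the new vertices before `τ_i` are sent to
`a`, those after `τ_i` to `b`. -/
def retract : V ⊕ Fin n → V :=
  Sum.elim id fun k => if k.castSucc.succ ≤ i.castSucc then a else b

theorem retract_subdivVertex (m : Fin (n + 2)) :
    retract a b i (subdivVertex a b n m) = if m ≤ i.castSucc then a else b := by
  refine subdivVertex_cases a b
    (motive := fun m x => retract a b i x = if m ≤ i.castSucc then a else b) ?_ ?_ (fun _ => rfl) m
  · rw [if_pos (Fin.zero_le _)]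
    rfl
  · rw [if_neg (not_le.2 (Fin.castSucc_lt_last i))]
    rfl

theorem retract_subdivVertex_castSucc : retract a b i (subdivVertex a b n i.castSucc) = a := by
  rw [retract_subdivVertex, if_pos le_rfl]

theorem retract_subdivVertex_succ : retract a b i (subdivVertex a b n i.succ) = b := by
  rw [retract_subdivVertex, if_neg (not_le.2 Fin.castSucc_lt_succ)]

variable {i}

theorem retract_subdivVertex_succ_eq_of_ne {j : Fin (n + 1)} (hj : j ≠ i) :
    retract a b i (subdivVertex a b n j.succ) =
      retract a b i (subdivVertex a b n j.castSucc) := by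
  simp only [retract_subdivVertex, succ_le_castSucc_iff_of_ne hj]

variable {a b} {G : WeightedDigraph V} {hab : G.Adj a b} {S : stdSimplex ℝ (Fin (n + 1))}

theorem cutSubdivision_adj_inl {u v : V} (h : (G.deleteEdge a b).Adj u v) :
    (G.cutSubdivision hab S i).Adj (Sum.inl u) (Sum.inl v) := by
  refine ⟨.old u v h.1 h.2, fun heq => h.2 ?_⟩
  obtain ⟨hu, hv⟩ := Prod.mk.inj heq
  rw [← retract_subdivVertex_castSucc a b i, ← hu, ← retract_subdivVertex_succ a b i, ← hv]
  rfl

theorem dist_cutSubdivision_inl_le (u v : V) :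
    (G.cutSubdivision hab S i).dist (Sum.inl u) (Sum.inl v) ≤ (G.deleteEdge a b).dist u v := by
  have h := le_dist_add (G := G.deleteEdge a b)
    (F := fun u => (G.cutSubdivision hab S i).dist (Sum.inl u) (Sum.inl v)) (fun u u' h => ?_) u v
  · rwa [dist_self, add_zero] at h
  · exact (dist_le_weight_add_dist (cutSubdivision_adj_inl h) _).trans_eq
      (congrArg (ENNReal.ofReal · + _) (subdivWeight_old G a b n S u u' h.2))

/-- The retraction of a shortest path of `G_S` either avoids the edge `(a, b)` or can be shortened
so as to use it exactly once. -/
theorem min_dist_retract_le (i : Fin (n + 1)) (x y : V ⊕ Fin n) :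
    min ((G.deleteEdge a b).dist (retract a b i x) (retract a b i y))
      ((G.deleteEdge a b).dist (retract a b i x) a + (G.deleteEdge a b).dist b (retract a b i y)) ≤
      (G.subdivide hab S).dist x y := by
  let F (x : V ⊕ Fin n) : ℝ≥0∞ :=
    min ((G.deleteEdge a b).dist (retract a b i x) (retract a b i y))
      ((G.deleteEdge a b).dist (retract a b i x) a + (G.deleteEdge a b).dist b (retract a b i y))
  have hF (x x') (h : (G.subdivide hab S).Adj x x') :
      F x ≤ ENNReal.ofReal ((G.subdivide hab S).weight x x') + F x' := by
    cases h with
    | old u v huv hne =>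
      have hstep (z) := dist_le_weight_add_dist (G := G.deleteEdge a b) ⟨huv, hne⟩ z
      rw [show (G.subdivide hab S).weight (Sum.inl u) (Sum.inl v) = (G.deleteEdge a b).weight u v
        from subdivWeight_old G a b n S u v hne, ← min_add_add_left, ← add_assoc]
      exact min_le_min (hstep _) (add_le_add_left (hstep _) _)
    | daughter j =>
      refine le_add_left ?_
      by_cases hj : j = i
      · subst hj
        simp only [F, retract_subdivVertex_castSucc, retract_subdivVertex_succ, dist_self, zero_add]
        exact le_min (min_le_right _ _) ((min_le_right _ _).trans le_add_self)
      · simp only [F, retract_subdivVertex_succ_eq_of_ne a b hj, le_refl]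
  have hFy : F y ≤ 0 := (min_le_left _ _).trans_eq (dist_self _)
  simpa only [nonpos_iff_eq_zero.1 hFy, add_zero] using le_dist_add hF x y

theorem dist_cutSubdivision_retract_le (x y : V ⊕ Fin n) :
    (G.cutSubdivision hab S i).dist (Sum.inl (retract a b i x)) (Sum.inl (retract a b i y)) ≤
      (G.subdivide hab S).dist x y + (G.deleteEdge a b).dist a b := by
  refine (dist_cutSubdivision_inl_le _ _).trans
    (le_trans ?_ (add_le_add_left (min_dist_retract_le i x y) _))
  rw [← min_add_add_right]
  refine le_min le_self_add ?_
  calc (G.deleteEdge a b).dist (retract a b i x) (retract a b i y)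
    _ ≤ (G.deleteEdge a b).dist (retract a b i x) a +
        ((G.deleteEdge a b).dist a b + (G.deleteEdge a b).dist b (retract a b i y)) :=
      (dist_triangle _ a _).trans (add_le_add_right (dist_triangle a b _) _)
    _ = _ := by rw [add_right_comm, add_assoc]

variable (a b)

/-- The `j`-th daughter edge, as a chain. -/
noncomputable def daughterChain (j : Fin (n + 1)) : Chain (V ⊕ Fin n) 1 :=
  edgeChain (subdivVertex a b n j.castSucc) (subdivVertex a b n j.succ)

/-- The signed sum of daughter edges along which the `m`-th vertex of the subdivided edge is joined
to its retraction. -/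
noncomputable def retractChain (i : Fin (n + 1)) (m : Fin (n + 2)) : Chain (V ⊕ Fin n) 1 :=
  Fin.partialSum (daughterChain a b) m - if m ≤ i.castSucc then 0 else ∑ j, daughterChain a b j

/-- The homotopy between the retraction and the identity, on vertices. -/
noncomputable def retractHomotopy (i : Fin (n + 1)) : V ⊕ Fin n → Chain (V ⊕ Fin n) 1 :=
  Sum.elim 0 fun k => retractChain a b i k.castSucc.succ

theorem retractHomotopy_subdivVertex (m : Fin (n + 2)) :
    retractHomotopy a b i (subdivVertex a b n m) = retractChain a b i m := by
  refine subdivVertex_cases a b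
    (motive := fun m x => retractHomotopy a b i x = retractChain a b i m) ?_ ?_ (fun _ => rfl) m
  · rw [retractChain, if_pos (Fin.zero_le _), Fin.partialSum_zero, sub_zero]
    rfl
  · rw [retractChain, if_neg (not_le.2 (Fin.castSucc_lt_last i)), partialSum_last, sub_self]
    rfl

variable {a b}

theorem retractHomotopy_sub {x y : V ⊕ Fin n} (h : (G.cutSubdivision hab S i).Adj x y) :
    retractHomotopy a b i y - retractHomotopy a b i x =
      edgeChain x y - edgeChain (Sum.inl (retract a b i x)) (Sum.inl (retract a b i y)) := by
  obtain ⟨h, hne⟩ := h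
  cases h with
  | old u v _ _ => simp [retract, retractHomotopy]
  | daughter j =>
    have hj : j ≠ i := by
      rintro rfl
      exact hne rfl
    rw [retract_subdivVertex_succ_eq_of_ne a b hj, edgeChain_self, sub_zero,
      retractHomotopy_subdivVertex, retractHomotopy_subdivVertex, retractChain, retractChain,
      Fin.partialSum_succ]
    simp only [succ_le_castSucc_iff_of_ne hj]
    rw [sub_sub_sub_cancel_right, add_sub_cancel_left]
    rfl

theorem mem_groundedBoundaries_cutSubdivision {d : ℝ≥0} (hd : (G.deleteEdge a b).dist a b ≤ d)
    {t : ℝ≥0} {z : Chain (V ⊕ Fin n) 1} (hz : z ∈ (G.cutSubdivision hab S i).cycles)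
    (hzt : z ∈ (G.subdivide hab S).groundedBoundaries t) :
    z ∈ (G.cutSubdivision hab S i).groundedBoundaries (t + d) := by
  have hfix : pushforward (fun x => Sum.inl (retract a b i x)) 1 z = z :=
    pushforward_eq_self_of_homotopy (retractHomotopy a b i) (fun x y h => retractHomotopy_sub h)
      (loopless _) hz.1 hz.2
  rw [← hfix]
  refine pushforward_mem_boundaries (D := (G.subdivide hab S).sublevel t)
    (D' := (G.cutSubdivision hab S i).sublevel (t + d)) (fun x y hxy hne => ⟨hne, ?_⟩) hzt
  rw [ENNReal.coe_add]
  exact (dist_cutSubdivision_retract_le x y).trans (add_le_add hxy.2 hd)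

theorem dist_subdivVertex_castSucc_succ_le (j : Fin (n + 1)) :
    (G.subdivide hab S).dist (subdivVertex a b n j.castSucc) (subdivVertex a b n j.succ) ≤
      ENNReal.ofReal (S.1 j * G.weight a b) :=
  (dist_le_weight (SubdivAdj.daughter j)).trans_eq
    (congrArg ENNReal.ofReal (subdivWeight_daughter G a b n S j))

theorem sum_ofReal_share (hab : G.Adj a b) (S : stdSimplex ℝ (Fin (n + 1))) :
    ∑ j, ENNReal.ofReal (S.1 j * G.weight a b) = ENNReal.ofReal (G.weight a b) := by
  rw [← ENNReal.ofReal_sum_of_nonneg fun j _ => mul_nonneg (S.2.1 j) (G.weight_nonneg a b hab),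
    ← Finset.sum_mul]
  exact congrArg ENNReal.ofReal ((congrArg (· * _) S.2.2).trans (one_mul _))

theorem dist_inl_subdivVertex_le (m : Fin (n + 2)) :
    (G.subdivide hab S).dist (Sum.inl a) (subdivVertex a b n m) ≤
      ENNReal.ofReal (G.weight a b) := by
  have hpartial : (G.subdivide hab S).dist (Sum.inl a) (subdivVertex a b n m) ≤
      Fin.partialSum (fun j => ENNReal.ofReal (S.1 j * G.weight a b)) m := by
    induction m using Fin.induction with
    | zero => rw [subdivVertex_zero, dist_self, Fin.partialSum_zero]
    | succ j ih =>
      rw [Fin.partialSum_succ]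
      exact (dist_triangle _ _ _).trans (add_le_add ih (dist_subdivVertex_castSucc_succ_le j))
  refine hpartial.trans ?_
  rw [← sum_ofReal_share hab S, ← List.sum_ofFn]
  exact (List.take_sublist _ _).sum_le_sum fun _ _ => zero_le

theorem edgeChain_sub_partialSum_mem_groundedBoundaries {t : ℝ≥0}
    (ht : ENNReal.ofReal (G.weight a b) ≤ t) (m : Fin (n + 2)) :
    edgeChain (Sum.inl a) (subdivVertex a b n m) - Fin.partialSum (daughterChain a b) m ∈
      (G.subdivide hab S).groundedBoundaries t := by
  induction m using Fin.induction with
  | zero =>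
    rw [subdivVertex_zero, edgeChain_self, Fin.partialSum_zero, sub_zero]
    exact Submodule.zero_mem _
  | succ j ih =>
    have hj : (G.subdivide hab S).dist (subdivVertex a b n j.castSucc) (subdivVertex a b n j.succ) ≤
        ENNReal.ofReal (G.weight a b) := by
      rw [← sum_ofReal_share hab S]
      exact (dist_subdivVertex_castSucc_succ_le j).trans
        (Finset.single_le_sum (f := fun j => ENNReal.ofReal (S.1 j * G.weight a b))
          (fun _ _ => zero_le) (Finset.mem_univ j))
    have htriangle := triangle_mem_groundedBoundaries ((dist_inl_subdivVertex_le _).trans ht)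
      (hj.trans ht) ((dist_inl_subdivVertex_le _).trans ht)
    rw [Fin.partialSum_succ, daughterChain]
    convert Submodule.add_mem _ ih htriangle using 1
    abel

theorem daughterChain_mem_allowedChains (j : Fin (n + 1)) :
    daughterChain a b j ∈ allowedChains (G.subdivide hab S).toDigraph 1 :=
  edgeChain_mem fun _ => .daughter j

theorem coord_sum_daughterChain_pos (hab : G.Adj a b) (i : Fin (n + 1)) :
    0 < (pathBasis (V ⊕ Fin n) 1).coord
      ![subdivVertex a b n i.castSucc, subdivVertex a b n i.succ] (∑ j, daughterChain a b j) := by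
  have hdaughter (j : Fin (n + 1)) : daughterChain a b j =
      pathBasis (V ⊕ Fin n) 1 ![subdivVertex a b n j.castSucc, subdivVertex a b n j.succ] :=
    edgeChain_of_ne (not_subdivAdj_self G hab n _ _ (.daughter j))
  simp only [map_sum, hdaughter, Module.Basis.coord_apply, Module.Basis.repr_self]
  refine Finset.sum_pos' (fun j _ => Finsupp.single_nonneg.2 zero_le_one _)
    ⟨i, Finset.mem_univ i, ?_⟩
  rw [Finsupp.single_eq_same]
  exact one_pos

theorem exists_cycle_mem_groundedBoundaries [Finite V] {t : ℝ≥0}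
    (hd : (G.deleteEdge a b).dist a b ≤ t) (ht : ENNReal.ofReal (G.weight a b) ≤ t) :
    ∃ z ∈ (G.subdivide hab S).cycles, z ∈ (G.subdivide hab S).groundedBoundaries t ∧
      (pathBasis (V ⊕ Fin n) 1).coord
        ![subdivVertex a b n i.castSucc, subdivVertex a b n i.succ] z ≠ 0 := by
  obtain ⟨y, hy, hbypass⟩ := exists_edgeChain_sub_mem_groundedBoundaries
    ((dist_cutSubdivision_inl_le (hab := hab) (S := S) (i := i) a b).trans hd)
  have hedge :=
    edgeChain_sub_partialSum_mem_groundedBoundaries (hab := hab) (S := S) ht (Fin.last (n + 1))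
  rw [subdivVertex_last, partialSum_last] at hedge
  have hz : ∑ j, daughterChain a b j - y ∈ (G.subdivide hab S).groundedBoundaries t := by
    convert Submodule.sub_mem _ (groundedBoundaries_deleteEdge_le _ _ t hbypass) hedge using 1
    abel
  have hy' : y ∈ allowedChains (G.subdivide hab S).toDigraph 1 :=
    allowedChains_mono (D := (G.cutSubdivision hab S i).toDigraph) (fun _ _ h => h.1) 1 hy
  refine ⟨_, ⟨Submodule.sub_mem _ (Submodule.sum_mem _ fun j _ =>
    daughterChain_mem_allowedChains j) hy', boundary_eq_zero_of_mem_groundedBoundaries hz⟩, hz, ?_⟩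
  have hcoord : (pathBasis (V ⊕ Fin n) 1).coord
      ![subdivVertex a b n i.castSucc, subdivVertex a b n i.succ] y = 0 :=
    mem_allowedChains_iff.1 hy _ fun h => (isAllowedPath_one.1 h).2 rfl
  rw [map_sub, hcoord, sub_zero]
  exact (coord_sum_daughterChain_pos hab i).ne'

theorem bottleneckDist_cutSubdivision_le [Finite V] {B C : Barcode}
    (hB : (G.subdivide hab S).groundedPersistentHomology.HasBarcode B)
    (hC : (G.cutSubdivision hab S i).groundedPersistentHomology.HasBarcode C) :
    Barcode.bottleneckDist B C ≤
      max ((G.deleteEdge a b).dist a b) (ENNReal.ofReal (G.weight a b / 2)) := by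
  by_cases htop : (G.deleteEdge a b).dist a b = ⊤
  · rw [htop, max_eq_left le_top]
    exact le_top
  lift (G.deleteEdge a b).dist a b to ℝ≥0 using htop with d hd
  let w : ℝ≥0 := (G.weight a b).toNNReal
  have hbound : Barcode.bottleneckDist B C ≤ max (d : ℝ≥0∞) ((max d w : ℝ≥0) / 2) :=
    bottleneckDist_deleteEdge_le _ _
      (fun t z hz hzt => mem_groundedBoundaries_cutSubdivision hd.ge hz hzt)
      (exists_cycle_mem_groundedBoundaries (hd.ge.trans (ENNReal.coe_le_coe.2 (le_max_left d w)))
        (ENNReal.coe_le_coe.2 (le_max_right d w))) hB hC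
  refine hbound.trans (max_le (le_max_left _ _) ?_)
  rw [ENNReal.ofReal_div_of_pos two_pos, ENNReal.ofReal_ofNat]
  rcases le_total d w with h | h
  · rw [max_eq_right h]
    exact le_max_right _ _
  · rw [max_eq_left h]
    exact le_max_of_le_left ENNReal.half_le_self

end CutSubdivision

end WeightedDigraph

theorem mainTheorem9 {V : Type*} [Finite V] (G : WeightedDigraph V) (hG : G.IsPositive)
    (a b : V) (hab : G.Adj a b) (n : ℕ) (S : stdSimplex ℝ (Fin (n + 1))) (i : Fin (n + 1)) :
    (∃ B : Barcode, (G.subdivide hab S).groundedPersistentHomology.HasBarcode B) ∧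
    (∃ C : Barcode,
      ((G.subdivide hab S).deleteEdge (WeightedDigraph.subdivVertex a b n i.castSucc)
        (WeightedDigraph.subdivVertex a b n i.succ)).groundedPersistentHomology.HasBarcode C) ∧
    ∀ B C : Barcode,
      (G.subdivide hab S).groundedPersistentHomology.HasBarcode B →
      ((G.subdivide hab S).deleteEdge (WeightedDigraph.subdivVertex a b n i.castSucc)
        (WeightedDigraph.subdivVertex a b n i.succ)).groundedPersistentHomology.HasBarcode C →
      Barcode.bottleneckDist B C ≤
        max ((G.deleteEdge a b).dist a b) (ENNReal.ofReal (G.weight a b / 2)) :=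
  ⟨(WeightedDigraph.cyclePresentation _).exists_hasBarcode,
    (WeightedDigraph.cyclePresentation _).exists_hasBarcode,
    fun _ _ => WeightedDigraph.bottleneckDist_cutSubdivision_le⟩
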